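/- Let $K$ be a field of characteristic $0$. Let $\mathcal P=\mathbb T(E)/(R)$ be a binary quadratic operad: $E$ is a right $K[\mathbb S_2]$-module placed in arity $2$, $\mathbb T(E)$ is the free symmetric operad on $E$, and $(R)$ is the operadic ideal generated by an $\mathbb S_3$-submodule $R\subseteq\mathbb T(E)(3)$. Let $\mathfrak a$ be a finite-dimensional $\mathcal P$-algebra with structure morphism $\gamma:\mathcal P\to\mathrm{End}_{\mathfrak a}$ and basis $a_1,\dots,a_n$. For $\mu\in\mathcal P(k)$ write $$\gamma_k(\mu)(a_{i_1},\dots,a_{i_k})=\sum_{s=1}^n\alpha^s_{\gamma_k(\mu),i_1,\dots,i_k}\,a_s .$$ The universal polynomials of $\mathfrak a$ are $$P_{(\mu,a,i_1,\dots,i_k)}=\sum_{u=1}^n\alpha^u_{\gamma_k(\mu),i_1,\dots,i_k}X_{au}-\sum_{s_1,\dots,s_k=1}^n\alpha^a_{\gamma_k(\mu),s_1,\dots,s_k}X_{s_1i_1}\cdots X_{s_ki_k}\in K[X_{si}\mid s,i=1,\dots,n],$$ for all $k\ge 0$, $\mu\in\mathcal P(k)$ and $a,i_1,\dots,i_k\in\{1,\dots,n\}$.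 Let $J$ be the ideal generated by all of them, and let $\mathcal C(\mathfrak a)=K[X_{si}]/J$ be the universal algebra of $\mathfrak a$. It is a bialgebra with $\Delta(x_{st})=\sum_r x_{sr}\otimes x_{rt}$ and $\varepsilon(x_{st})=\delta_{st}$, and it coacts on $\mathfrak a$ by $\eta(a_i)=\sum_s a_s\otimes x_{si}$. (1) The canonical map $E\to\mathcal P(2)$ is an isomorphism, and $J$ is generated by the universal polynomials $P_{(\mu,a,i_1,i_2)}$, where $\mu$ runs through any basis of $\mathcal P(2)=E$ and $a,i_1,i_2\in\{1,\dots,n\}$. (2) Consequently the constructions agree with those for associative, Leibniz, Lie and Poisson algebras, in the following sense. Let $A$ be a finite-dimensional vector space with basis $a_1,\dots,a_n$. For $\mathcal P=\mathcal Ass,\ \mathcal Leib,\ \mathcal Lie$, with generating operation $\mu$, the assignment $\gamma\mapsto\gamma_2(\mu)$ is a bijection from the $\mathcal P$-algebra structures on $A$ to, respectively, the associative (not necessarily unital) products, the right Leibniz brackets and the Lie brackets on $A$. For $\mathcal P=\mathcal Pois$, with generating operations $c$ (the bracket) and $\mu$ (the commutative product), the assignment $\gamma\mapsto(\gamma_2(c),\gamma_2(\mu))$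 is a bijection from the $\mathcal Pois$-algebra structures on $A$ to the Poisson algebra structures on $A$. In each case $J$ is generated by the polynomials $$\sum_{u=1}^n\alpha^u_{i,j}X_{au}-\sum_{s,t=1}^n\alpha^a_{s,t}X_{si}X_{tj}\qquad(a,i,j=1,\dots,n),$$ where $\alpha^u_{i,j}$ are the structure constants of the generating operation (for $\mathcal Pois$: of each of the two generating operations). Moreover $\mathcal C(\mathfrak a)$, as a bialgebra together with its coaction on $\mathfrak a$, is the one constructed from the classical operation(s) alone. A commutative bialgebra (respectively, a commutative Hopf algebra) with a coaction on $\mathfrak a$ is initial among those coacting on $\mathfrak a$ compatibly with all operations of $\mathcal P$ if and only if it is initial among those coacting compatibly with the classical operation(s). The same holds for the free commutative Hopf algebra on the bialgebra $\mathcal C(\mathfrak a)$ with its induced coaction. -/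

import Mathlib

open scoped TensorProduct

universe u v w y

/-! ## Symmetric operads (partial definition) -/

/-- The inputs of a partial composite `μ ∘ᵢ ν`, with `μ` of arity `m`, `ν` of arity `n` and
`l + 1 = m + n`, numbered as usual: first the inputs of `μ` before the `i`-th one, then the inputs
of `ν`, then the inputs of `μ` after the `i`-th one.  The argument is either an input of `μ` other
than the `i`-th, or an input of `ν`. -/
def slotPos {m n l : ℕ} (h : l + 1 = m + n) (i : Fin m) : {j : Fin m // j ≠ i} ⊕ Fin n → Fin l
  | Sum.inl j =>
      ⟨if j.1.1 < i.1 then j.1.1 else j.1.1 + n - 1, by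
        have := i.2
        have := j.1.2
        have : j.1.1 ≠ i.1 := fun e => j.2 (Fin.ext e)
        split <;> omega⟩
  | Sum.inr k => ⟨i.1 + k.1, by have := i.2; have := k.2; omega⟩

theorem slotPos_bijective {m n l : ℕ} (h : l + 1 = m + n) (i : Fin m) :
    Function.Bijective (slotPos h i) := by
  have hi := i.2
  constructor
  · rintro (j | k) (j' | k') e <;> have e' := congrArg Fin.val e <;> simp only [slotPos] at e'
    · have h1 : j.1.1 ≠ i.1 := fun e => j.2 (Fin.ext e)
      have h2 : j'.1.1 ≠ i.1 := fun e => j'.2 (Fin.ext e)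
      congr 1
      apply Subtype.ext
      apply Fin.ext
      split at e' <;> split at e' <;> omega
    · have h1 : j.1.1 ≠ i.1 := fun e => j.2 (Fin.ext e)
      have := k'.2
      split at e' <;> omega
    · have h1 : j'.1.1 ≠ i.1 := fun e => j'.2 (Fin.ext e)
      have := k.2
      split at e' <;> omega
    · congr 1
      apply Fin.ext
      omega
  · intro p
    have hp := p.2
    by_cases h₁ : p.1 < i.1
    · refine ⟨Sum.inl ⟨⟨p.1, by omega⟩, fun e => ?_⟩, ?_⟩
      · have := congrArg Fin.val e
        simp only at this
        omega
      · apply Fin.ext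
        simp [slotPos, h₁]
    · by_cases h₂ : p.1 < i.1 + n
      · refine ⟨Sum.inr ⟨p.1 - i.1, by omega⟩, Fin.ext ?_⟩
        simp only [slotPos]
        omega
      · refine ⟨Sum.inl ⟨⟨p.1 + 1 - n, by omega⟩, fun e => ?_⟩, Fin.ext ?_⟩
        · have := congrArg Fin.val e
          simp only at this
          omega
        · simp only [slotPos]
          split <;> omega

@[simp] theorem slotPos_inj {m n l : ℕ} (h : l + 1 = m + n) (i : Fin m)
    (x y : {j : Fin m // j ≠ i} ⊕ Fin n) : slotPos h i x = slotPos h i y ↔ x = y :=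
  (slotPos_bijective h i).1.eq_iff

theorem slotPos_inl_val {m n l : ℕ} (h : l + 1 = m + n) (i : Fin m) (j : {j : Fin m // j ≠ i}) :
    (slotPos h i (Sum.inl j)).1 = if j.1.1 < i.1 then j.1.1 else j.1.1 + n - 1 := rfl

theorem slotPos_inr_val {m n l : ℕ} (h : l + 1 = m + n) (i : Fin m) (k : Fin n) :
    (slotPos h i (Sum.inr k)).1 = i.1 + k.1 := rfl

/-- `slotPos` as an equivalence. -/
noncomputable def slotEquiv {m n l : ℕ} (h : l + 1 = m + n) (i : Fin m) :
    {j : Fin m // j ≠ i} ⊕ Fin n ≃ Fin l :=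
  Equiv.ofBijective (slotPos h i) (slotPos_bijective h i)

/-- The block permutation `σ ∘ᵢ τ`.  Permutations act on inputs so that the `j`-th input of `μ · σ`
is fed into the `σ j`-th input of `μ`. -/
noncomputable def blockPerm {m n l : ℕ} (h : l + 1 = m + n) (i : Fin m)
    (σ : Equiv.Perm (Fin m)) (τ : Equiv.Perm (Fin n)) : Equiv.Perm (Fin l) :=
  (slotEquiv h i).symm.trans
    ((Equiv.sumCongr
      (σ.subtypeEquiv (p := fun j => j ≠ i) (q := fun j => j ≠ σ i)
        (fun _ => (σ.injective.ne_iff).symm)) τ).trans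
      (slotEquiv h (σ i)))

/-- A symmetric operad over `K`: right `K[𝕊ₙ]`-modules `obj n` (a right action is a representation
of the opposite group), bilinear partial compositions and a unit, with the usual axioms.  Positions
are counted from `0`, and the arity `l = m + n - 1` of a composite is carried by an equation. -/
structure SymOperad (K : Type u) [Field K] where
  obj : ℕ → Type v
  [addCommGroup : ∀ n, AddCommGroup (obj n)]
  [module : ∀ n, Module K (obj n)]
  act : ∀ n, Representation K (Equiv.Perm (Fin n))ᵐᵒᵖ (obj n)
  comp : ∀ {m n l : ℕ}, l + 1 = m + n → Fin m → (obj m →ₗ[K] obj n →ₗ[K] obj l)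
  one : obj 1
  comp_sequential : ∀ {l m n p q r : ℕ} (h₁ : p + 1 = l + m) (h₂ : q + 1 = p + n)
    (h₃ : r + 1 = m + n) (h₄ : q + 1 = l + r) (i : Fin l) (j : Fin m)
    (x : obj l) (y : obj m) (z : obj n),
    comp h₂ (slotPos h₁ i (Sum.inr j)) (comp h₁ i x y) z
      = comp h₄ i x (comp h₃ j y z)
  comp_parallel : ∀ {l m n p q r : ℕ} (h₁ : p + 1 = l + m) (h₂ : q + 1 = p + n)
    (h₃ : r + 1 = l + n) (h₄ : q + 1 = r + m) (i k : Fin l) (hik : i ≠ k)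
    (x : obj l) (y : obj m) (z : obj n),
    comp h₂ (slotPos h₁ i (Sum.inl ⟨k, hik.symm⟩)) (comp h₁ i x y) z
      = comp h₄ (slotPos h₃ k (Sum.inl ⟨i, hik⟩)) (comp h₃ k x z) y
  equivariance : ∀ {m n l : ℕ} (h : l + 1 = m + n) (i : Fin m)
    (σ : Equiv.Perm (Fin m)) (τ : Equiv.Perm (Fin n)) (x : obj m) (y : obj n),
    comp h i (act m (MulOpposite.op σ) x) (act n (MulOpposite.op τ) y)
      = act l (MulOpposite.op (blockPerm h i σ τ)) (comp h (σ i) x y)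
  comp_one : ∀ {m : ℕ} (h : m + 1 = m + 1) (i : Fin m) (x : obj m), comp h i x one = x
  one_comp : ∀ {n : ℕ} (h : n + 1 = 1 + n) (x : obj n), comp h 0 one x = x

attribute [instance] SymOperad.addCommGroup SymOperad.module

/-- Morphisms of operads. -/
structure SymOperad.Hom {K : Type u} [Field K] (P : SymOperad.{u, v} K) (Q : SymOperad.{u, w} K)
    where
  app : ∀ n, P.obj n →ₗ[K] Q.obj n
  map_one : app 1 P.one = Q.one
  map_comp : ∀ {m n l : ℕ} (h : l + 1 = m + n) (i : Fin m) (x : P.obj m) (y : P.obj n),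
    app l (P.comp h i x y) = Q.comp h i (app m x) (app n y)
  map_act : ∀ (n : ℕ) (σ : Equiv.Perm (Fin n)) (x : P.obj n),
    app n (P.act n (MulOpposite.op σ) x) = Q.act n (MulOpposite.op σ) (app n x)

/-! ## The endomorphism operad and algebras over an operad -/

section EndOperad

variable {K : Type u} {A : Type w}

/-- The input vector of the outer operation in `f ∘ᵢ g`: the value `g (…)` is put in position `i`. -/
def outerInput {m n l : ℕ} (h : l + 1 = m + n) (i : Fin m) (g : (Fin n → A) → A)
    (a : Fin l → A) : Fin m → A := fun j =>
  if hj : j = i then g (fun k => a (slotPos h i (Sum.inr k)))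
  else a (slotPos h i (Sum.inl ⟨j, hj⟩))

theorem outerInput_self {m n l : ℕ} (h : l + 1 = m + n) (i : Fin m) (g : (Fin n → A) → A)
    (a : Fin l → A) : outerInput h i g a i = g (fun k => a (slotPos h i (Sum.inr k))) := by
  simp [outerInput]

theorem outerInput_of_ne {m n l : ℕ} (h : l + 1 = m + n) (i : Fin m) (g : (Fin n → A) → A)
    (a : Fin l → A) {j : Fin m} (hj : j ≠ i) :
    outerInput h i g a j = a (slotPos h i (Sum.inl ⟨j, hj⟩)) := by
  simp [outerInput, hj]

theorem outerInput_eq {m n l : ℕ} (h : l + 1 = m + n) (i : Fin m) (f : Fin m → A)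
    (a : Fin l → A) (g : (Fin n → A) → A)
    (hi : g (fun k => a (slotPos h i (Sum.inr k))) = f i)
    (hj : ∀ (j : Fin m) (hj : j ≠ i), a (slotPos h i (Sum.inl ⟨j, hj⟩)) = f j) :
    outerInput h i g a = f := by
  funext j
  by_cases h' : j = i
  · subst h'; rw [outerInput_self, hi]
  · rw [outerInput_of_ne h i g a h', hj j h']

theorem outerInput_update_inr {m n l : ℕ} (h : l + 1 = m + n) (i : Fin m) (g : (Fin n → A) → A)
    (a : Fin l → A) (k : Fin n) (x : A) :
    outerInput h i g (Function.update a (slotPos h i (Sum.inr k)) x)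
      = Function.update (outerInput h i g a) i
        (g (Function.update (fun k => a (slotPos h i (Sum.inr k))) k x)) := by
  refine outerInput_eq h i _ _ g ?_ fun j hj => ?_
  · simp only [Function.update_self]
    congr 1
    funext k'
    simp [Function.update_apply]
  · simp [hj, outerInput_of_ne h i g a hj]

theorem outerInput_update_inl {m n l : ℕ} (h : l + 1 = m + n) (i : Fin m) (g : (Fin n → A) → A)
    (a : Fin l → A) (k : {j : Fin m // j ≠ i}) (x : A) :
    outerInput h i g (Function.update a (slotPos h i (Sum.inl k)) x)
      = Function.update (outerInput h i g a) k.1 x := by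
  refine outerInput_eq h i _ _ g ?_ fun j hj => ?_
  · rw [Function.update_of_ne k.2.symm, outerInput_self]
    simp
  · simp [Function.update_apply, outerInput_of_ne h i g a hj, Subtype.ext_iff]

variable [Field K] [AddCommGroup A] [Module K A]

/-- `(f ∘ᵢ g)(a₁, …) = f(a₁, …, g(aᵢ, …), …)`. -/
def endComp {m n l : ℕ} (h : l + 1 = m + n) (i : Fin m)
    (f : MultilinearMap K (fun _ : Fin m => A) A) (g : MultilinearMap K (fun _ : Fin n => A) A) :
    MultilinearMap K (fun _ : Fin l => A) A :=
  MultilinearMap.mk' (fun a => f (outerInput h i g a))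
    (by
      intro a p x x'
      obtain ⟨q, rfl⟩ := (slotPos_bijective h i).2 p
      rcases q with k | k
      · simp only [outerInput_update_inl, MultilinearMap.map_update_add]
      · simp only [outerInput_update_inr, MultilinearMap.map_update_add])
    (by
      intro a p c x
      obtain ⟨q, rfl⟩ := (slotPos_bijective h i).2 p
      rcases q with k | k
      · simp only [outerInput_update_inl, MultilinearMap.map_update_smul]
      · simp only [outerInput_update_inr, MultilinearMap.map_update_smul])

@[simp] theorem endComp_apply {m n l : ℕ} (h : l + 1 = m + n) (i : Fin m)
    (f : MultilinearMap K (fun _ : Fin m => A) A) (g : MultilinearMap K (fun _ : Fin n => A) A)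
    (a : Fin l → A) : endComp h i f g a = f (outerInput h i g a) := rfl

theorem outerInput_eq_update {m n l : ℕ} (h : l + 1 = m + n) (i : Fin m) (g : (Fin n → A) → A)
    (a : Fin l → A) :
    outerInput h i g a = Function.update (outerInput h i (fun _ => 0) a) i
      (g (fun k => a (slotPos h i (Sum.inr k)))) := by
  refine outerInput_eq h i _ _ g ?_ fun j hj => ?_
  · simp
  · simp [Function.update_of_ne hj, outerInput_of_ne h i _ a hj]

theorem endComp_sequential {l m n p q r : ℕ} (h₁ : p + 1 = l + m) (h₂ : q + 1 = p + n)
    (h₃ : r + 1 = m + n) (h₄ : q + 1 = l + r) (i : Fin l) (j : Fin m)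
    (x : MultilinearMap K (fun _ : Fin l => A) A) (y : MultilinearMap K (fun _ : Fin m => A) A)
    (z : MultilinearMap K (fun _ : Fin n => A) A) :
    endComp h₂ (slotPos h₁ i (Sum.inr j)) (endComp h₁ i x y) z
      = endComp h₄ i x (endComp h₃ j y z) := by
  ext a
  simp only [endComp_apply]
  congr 1
  refine outerInput_eq _ _ _ _ _ ?_ fun k hk => ?_
  · rw [outerInput_self]
    simp only [endComp_apply]
    congr 1
    symm
    refine outerInput_eq _ _ _ _ _ ?_ fun s hs => ?_
    · rw [outerInput_self]
      congr 1
      funext t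
      congr 1
      apply Fin.ext
      simp only [slotPos_inr_val]
      omega
    · rw [outerInput_of_ne _ _ _ _ (by simpa using hs)]
      congr 1
      have hs' : s.1 ≠ j.1 := fun e => hs (Fin.ext e)
      have := s.2
      apply Fin.ext
      rw [slotPos_inl_val, slotPos_inr_val, slotPos_inl_val]
      rcases lt_or_gt_of_ne hs' with hlt | hlt
      · rw [if_pos hlt, if_pos (by simp only [slotPos_inr_val]; omega), slotPos_inr_val]
      · rw [if_neg (not_lt.2 hlt.le), if_neg (by simp only [slotPos_inr_val]; omega),
          slotPos_inr_val]
        dsimp only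
        omega
  · rw [outerInput_of_ne _ _ _ _ hk, outerInput_of_ne _ _ _ _ (by simp)]
    congr 1
    have hk' : k.1 ≠ i.1 := fun e => hk (Fin.ext e)
    have := j.2
    apply Fin.ext
    simp only [slotPos_inr_val, slotPos_inl_val]
    split_ifs <;> omega

theorem endComp_parallel {l m n p q r : ℕ} (h₁ : p + 1 = l + m) (h₂ : q + 1 = p + n)
    (h₃ : r + 1 = l + n) (h₄ : q + 1 = r + m) (i k : Fin l) (hik : i ≠ k)
    (x : MultilinearMap K (fun _ : Fin l => A) A) (y : MultilinearMap K (fun _ : Fin m => A) A)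
    (z : MultilinearMap K (fun _ : Fin n => A) A) :
    endComp h₂ (slotPos h₁ i (Sum.inl ⟨k, hik.symm⟩)) (endComp h₁ i x y) z
      = endComp h₄ (slotPos h₃ k (Sum.inl ⟨i, hik⟩)) (endComp h₃ k x z) y := by
  ext a
  simp only [endComp_apply]
  congr 1
  have hik' : i.1 ≠ k.1 := fun e => hik (Fin.ext e)
  refine outerInput_eq _ _ _ _ _ ?_ fun s hs => ?_
  · rw [outerInput_of_ne _ _ _ _ hik, outerInput_self]
    congr 1
    funext t
    have := t.2
    rw [outerInput_of_ne _ _ _ _ (by simp)]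
    congr 1
    apply Fin.ext
    simp only [slotPos_inr_val, slotPos_inl_val]
    split_ifs <;> omega
  · have hs' : s.1 ≠ i.1 := fun e => hs (Fin.ext e)
    by_cases hsk : s = k
    · subst hsk
      rw [outerInput_self, outerInput_self]
      congr 1
      funext t
      have := t.2
      rw [outerInput_of_ne _ _ _ _ (by simp)]
      congr 1
      apply Fin.ext
      simp only [slotPos_inr_val, slotPos_inl_val]
      split_ifs <;> omega
    · have hsk' : s.1 ≠ k.1 := fun e => hsk (Fin.ext e)
      rw [outerInput_of_ne _ _ _ _ hsk, outerInput_of_ne _ _ _ _ (by simpa using hsk),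
        outerInput_of_ne _ _ _ _ (by simpa using hs)]
      congr 1
      apply Fin.ext
      simp only [slotPos_inl_val]
      split_ifs <;> omega

theorem endComp_equivariance {m n l : ℕ} (h : l + 1 = m + n) (i : Fin m)
    (σ : Equiv.Perm (Fin m)) (τ : Equiv.Perm (Fin n))
    (x : MultilinearMap K (fun _ : Fin m => A) A) (y : MultilinearMap K (fun _ : Fin n => A) A) :
    endComp h i (x.domDomCongr σ⁻¹) (y.domDomCongr τ⁻¹)
      = (endComp h (σ i) x y).domDomCongr (blockPerm h i σ τ)⁻¹ := by
  ext a
  have hβ : ∀ q, (blockPerm h i σ τ)⁻¹ (slotPos h (σ i) q) = slotPos h i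
      (Sum.map (fun s => ⟨σ⁻¹ s.1, fun e => s.2 (by simpa using congrArg σ e)⟩)
        (fun k => τ⁻¹ k) q) := by
    intro q
    rw [Equiv.Perm.inv_eq_iff_eq]
    change _ = slotPos h (σ i) (Sum.map _ _ ((slotEquiv h i).symm (slotEquiv h i _)))
    rw [Equiv.symm_apply_apply]
    rcases q with s | k <;> simp
  simp only [endComp_apply, MultilinearMap.domDomCongr_apply]
  congr 1
  symm
  refine outerInput_eq _ _ _ _ _ ?_ fun s hs => ?_
  · rw [show σ⁻¹ (σ i) = i from σ.symm_apply_apply i, outerInput_self]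
    rw [MultilinearMap.domDomCongr_apply]
    congr 1
    funext k
    rw [hβ]
    rfl
  · have hs' : σ⁻¹ s ≠ i := fun e => hs (by rw [← e]; simp)
    rw [outerInput_of_ne _ _ _ _ hs', hβ]
    rfl

theorem endComp_one {m : ℕ} (h : m + 1 = m + 1) (i : Fin m)
    (x : MultilinearMap K (fun _ : Fin m => A) A) :
    endComp h i x (MultilinearMap.ofSubsingleton K A A (0 : Fin 1) LinearMap.id) = x := by
  ext a
  simp only [endComp_apply]
  congr 1
  refine outerInput_eq _ _ _ _ _ ?_ fun s hs => ?_
  · simp only [MultilinearMap.ofSubsingleton_apply_apply, LinearMap.id_apply]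
    congr 1
  · congr 1
    apply Fin.ext
    simp only [slotPos_inl_val]
    split_ifs <;> omega

theorem one_endComp {n : ℕ} (h : n + 1 = 1 + n) (x : MultilinearMap K (fun _ : Fin n => A) A) :
    endComp h 0 (MultilinearMap.ofSubsingleton K A A (0 : Fin 1) LinearMap.id) x = x := by
  ext a
  simp only [endComp_apply, MultilinearMap.ofSubsingleton_apply_apply,
    LinearMap.id_apply, outerInput_self]
  congr 1
  funext k
  congr 1
  apply Fin.ext
  simp [slotPos_inr_val]

variable (K A)

/-- The endomorphism operad of `A`, with `End_A(n)` the `n`-linear maps `Aⁿ → A`.  A permutation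
acts by `(f · σ)(a₁, …, aₙ) = f(a_{σ⁻¹(1)}, …, a_{σ⁻¹(n)})`, which is a right action. -/
noncomputable def endOperad : SymOperad.{u, w} K where
  obj n := MultilinearMap K (fun _ : Fin n => A) A
  act n :=
    { toFun := fun σ =>
        { toFun := fun f => f.domDomCongr σ.unop⁻¹
          map_add' := fun _ _ => rfl
          map_smul' := fun _ _ => rfl }
      map_one' := rfl
      map_mul' := fun _ _ => rfl }
  comp {m n l} h i := LinearMap.mk₂ K (endComp h i)
    (fun _ _ _ => rfl) (fun _ _ _ => rfl)
    (fun f g g' => by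
      ext a
      simp only [endComp_apply, add_apply]
      rw [outerInput_eq_update, outerInput_eq_update h i g, outerInput_eq_update h i g']
      simp)
    (fun c f g => by
      ext a
      simp only [endComp_apply, smul_apply]
      rw [outerInput_eq_update, outerInput_eq_update h i g]
      simp)
  one := MultilinearMap.ofSubsingleton K A A (0 : Fin 1) LinearMap.id
  comp_sequential := endComp_sequential
  comp_parallel := endComp_parallel
  equivariance := endComp_equivariance
  comp_one := endComp_one
  one_comp := one_endComp

end EndOperad

/-- An algebra over `P` with underlying space `A`: a morphism of operads `P → End_A`. -/
abbrev SymOperad.AlgebraOn {K : Type u} [Field K] (P : SymOperad.{u, v} K)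
    (A : Type w) [AddCommGroup A] [Module K A] := SymOperad.Hom P (endOperad K A)

/-- The `n`-ary operation of a `P`-algebra attached to `μ ∈ P(n)`. -/
noncomputable def SymOperad.Hom.op {K : Type u} [Field K] {P : SymOperad.{u, v} K}
    {A : Type w} [AddCommGroup A] [Module K A] (γ : P.AlgebraOn A) {n : ℕ} (μ : P.obj n) :
    MultilinearMap K (fun _ : Fin n => A) A := γ.app n μ

/-! ## The free operad on a right `𝕊₂`-module placed in arity two

Elements are formal expressions in the generators, built with the linear operations, the partial
compositions, the permutations and the unit, modulo the congruence that is generated by the axioms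
of an operad and by linearity and equivariance of the inclusion of the generators.  The universal
property is `freeOperad_universal`. -/

section FreeOperad

variable (K : Type u) [Field K] (E : Type v) [AddCommGroup E] [Module K E]

/-- Formal operadic expressions of arity `n` in binary generators from `E`. -/
inductive OperadTerm (K : Type u) (E : Type v) : ℕ → Type (max u v)
  | zero {n : ℕ} : OperadTerm K E n
  | add {n : ℕ} (x y : OperadTerm K E n) : OperadTerm K E n
  | smul {n : ℕ} (c : K) (x : OperadTerm K E n) : OperadTerm K E n
  | one : OperadTerm K E 1
  | gen (e : E) : OperadTerm K E 2
  | act {n : ℕ} (σ : Equiv.Perm (Fin n)) (x : OperadTerm K E n) : OperadTerm K E n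
  | comp {m n l : ℕ} (h : l + 1 = m + n) (i : Fin m) (x : OperadTerm K E m)
      (y : OperadTerm K E n) : OperadTerm K E l

variable {K E} (ρ : Representation K (Equiv.Perm (Fin 2))ᵐᵒᵖ E)

open OperadTerm in
/-- The congruence on formal expressions. -/
inductive OperadRel : ∀ {n : ℕ}, OperadTerm K E n → OperadTerm K E n → Prop
  | refl {n : ℕ} (x : OperadTerm K E n) : OperadRel x x
  | symm {n : ℕ} {x y : OperadTerm K E n} : OperadRel x y → OperadRel y x
  | trans {n : ℕ} {x y z : OperadTerm K E n} : OperadRel x y → OperadRel y z → OperadRel x z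
  | add_congr {n : ℕ} {x x' y y' : OperadTerm K E n} :
      OperadRel x x' → OperadRel y y' → OperadRel (add x y) (add x' y')
  | smul_congr {n : ℕ} (c : K) {x x' : OperadTerm K E n} :
      OperadRel x x' → OperadRel (smul c x) (smul c x')
  | act_congr {n : ℕ} (σ : Equiv.Perm (Fin n)) {x x' : OperadTerm K E n} :
      OperadRel x x' → OperadRel (act σ x) (act σ x')
  | comp_congr {m n l : ℕ} (h : l + 1 = m + n) (i : Fin m) {x x' : OperadTerm K E m}
      {y y' : OperadTerm K E n} :
      OperadRel x x' → OperadRel y y' → OperadRel (comp h i x y) (comp h i x' y')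
  | add_assoc {n : ℕ} (x y z : OperadTerm K E n) :
      OperadRel (add (add x y) z) (add x (add y z))
  | add_comm {n : ℕ} (x y : OperadTerm K E n) : OperadRel (add x y) (add y x)
  | zero_add {n : ℕ} (x : OperadTerm K E n) : OperadRel (add zero x) x
  | neg_add {n : ℕ} (x : OperadTerm K E n) : OperadRel (add (smul (-1) x) x) zero
  | smul_add {n : ℕ} (c : K) (x y : OperadTerm K E n) :
      OperadRel (smul c (add x y)) (add (smul c x) (smul c y))
  | add_smul {n : ℕ} (c d : K) (x : OperadTerm K E n) :
      OperadRel (smul (c + d) x) (add (smul c x) (smul d x))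
  | mul_smul {n : ℕ} (c d : K) (x : OperadTerm K E n) :
      OperadRel (smul (c * d) x) (smul c (smul d x))
  | one_smul {n : ℕ} (x : OperadTerm K E n) : OperadRel (smul 1 x) x
  | act_add {n : ℕ} (σ : Equiv.Perm (Fin n)) (x y : OperadTerm K E n) :
      OperadRel (act σ (add x y)) (add (act σ x) (act σ y))
  | act_smul {n : ℕ} (σ : Equiv.Perm (Fin n)) (c : K) (x : OperadTerm K E n) :
      OperadRel (act σ (smul c x)) (smul c (act σ x))
  | act_one {n : ℕ} (x : OperadTerm K E n) : OperadRel (act 1 x) x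
  | act_mul {n : ℕ} (σ τ : Equiv.Perm (Fin n)) (x : OperadTerm K E n) :
      OperadRel (act (σ * τ) x) (act τ (act σ x))
  | comp_add_left {m n l : ℕ} (h : l + 1 = m + n) (i : Fin m) (x x' : OperadTerm K E m)
      (y : OperadTerm K E n) :
      OperadRel (comp h i (add x x') y) (add (comp h i x y) (comp h i x' y))
  | comp_smul_left {m n l : ℕ} (h : l + 1 = m + n) (i : Fin m) (c : K) (x : OperadTerm K E m)
      (y : OperadTerm K E n) : OperadRel (comp h i (smul c x) y) (smul c (comp h i x y))
  | comp_add_right {m n l : ℕ} (h : l + 1 = m + n) (i : Fin m) (x : OperadTerm K E m)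
      (y y' : OperadTerm K E n) :
      OperadRel (comp h i x (add y y')) (add (comp h i x y) (comp h i x y'))
  | comp_smul_right {m n l : ℕ} (h : l + 1 = m + n) (i : Fin m) (c : K) (x : OperadTerm K E m)
      (y : OperadTerm K E n) : OperadRel (comp h i x (smul c y)) (smul c (comp h i x y))
  | comp_sequential {l m n p q r : ℕ} (h₁ : p + 1 = l + m) (h₂ : q + 1 = p + n)
      (h₃ : r + 1 = m + n) (h₄ : q + 1 = l + r) (i : Fin l) (j : Fin m)
      (x : OperadTerm K E l) (y : OperadTerm K E m) (z : OperadTerm K E n) :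
      OperadRel (comp h₂ (slotPos h₁ i (Sum.inr j)) (comp h₁ i x y) z)
        (comp h₄ i x (comp h₃ j y z))
  | comp_parallel {l m n p q r : ℕ} (h₁ : p + 1 = l + m) (h₂ : q + 1 = p + n)
      (h₃ : r + 1 = l + n) (h₄ : q + 1 = r + m) (i k : Fin l) (hik : i ≠ k)
      (x : OperadTerm K E l) (y : OperadTerm K E m) (z : OperadTerm K E n) :
      OperadRel (comp h₂ (slotPos h₁ i (Sum.inl ⟨k, hik.symm⟩)) (comp h₁ i x y) z)
        (comp h₄ (slotPos h₃ k (Sum.inl ⟨i, hik⟩)) (comp h₃ k x z) y)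
  | equivariance {m n l : ℕ} (h : l + 1 = m + n) (i : Fin m)
      (σ : Equiv.Perm (Fin m)) (τ : Equiv.Perm (Fin n)) (x : OperadTerm K E m)
      (y : OperadTerm K E n) :
      OperadRel (comp h i (act σ x) (act τ y)) (act (blockPerm h i σ τ) (comp h (σ i) x y))
  | comp_one {m : ℕ} (h : m + 1 = m + 1) (i : Fin m) (x : OperadTerm K E m) :
      OperadRel (comp h i x one) x
  | one_comp {n : ℕ} (h : n + 1 = 1 + n) (x : OperadTerm K E n) :
      OperadRel (comp h 0 one x) x
  | gen_add (e e' : E) : OperadRel (gen (e + e')) (add (gen e) (gen e'))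
  | gen_smul (c : K) (e : E) : OperadRel (gen (c • e)) (smul c (gen e))
  | gen_act (σ : Equiv.Perm (Fin 2)) (e : E) :
      OperadRel (gen (ρ (MulOpposite.op σ) e)) (act σ (gen e))

/-- The congruence as a setoid. -/
def operadSetoid (n : ℕ) : Setoid (OperadTerm K E n) :=
  ⟨OperadRel ρ, ⟨OperadRel.refl, OperadRel.symm, OperadRel.trans⟩⟩

/-- The underlying spaces of the free operad. -/
def FreeOperadObj (n : ℕ) : Type (max u v) := Quotient (operadSetoid ρ n)

namespace FreeOperadObj

variable {ρ} {n : ℕ}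

instance : Zero (FreeOperadObj ρ n) := ⟨Quotient.mk _ OperadTerm.zero⟩

instance : Add (FreeOperadObj ρ n) :=
  ⟨Quotient.map₂ OperadTerm.add fun _ _ h _ _ h' => OperadRel.add_congr h h'⟩

instance : SMul K (FreeOperadObj ρ n) :=
  ⟨fun c => Quotient.map (OperadTerm.smul c) fun _ _ h => OperadRel.smul_congr c h⟩

instance : Neg (FreeOperadObj ρ n) := ⟨fun x => (-1 : K) • x⟩

instance : AddCommGroup (FreeOperadObj ρ n) :=
  { nsmul := nsmulRec
    zsmul := zsmulRec
    add_assoc := by rintro ⟨x⟩ ⟨y⟩ ⟨z⟩; exact Quotient.sound (OperadRel.add_assoc x y z)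
    zero_add := by rintro ⟨x⟩; exact Quotient.sound (OperadRel.zero_add x)
    add_zero := by
      rintro ⟨x⟩
      exact Quotient.sound ((OperadRel.add_comm _ _).trans (OperadRel.zero_add x))
    add_comm := by rintro ⟨x⟩ ⟨y⟩; exact Quotient.sound (OperadRel.add_comm x y)
    neg_add_cancel := by rintro ⟨x⟩; exact Quotient.sound (OperadRel.neg_add x) }

instance : Module K (FreeOperadObj ρ n) :=
  Module.ofMinimalAxioms
    (by rintro c ⟨x⟩ ⟨y⟩; exact Quotient.sound (OperadRel.smul_add c x y))
    (by rintro c d ⟨x⟩; exact Quotient.sound (OperadRel.add_smul c d x))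
    (by rintro c d ⟨x⟩; exact Quotient.sound (OperadRel.mul_smul c d x))
    (by rintro ⟨x⟩; exact Quotient.sound (OperadRel.one_smul x))

end FreeOperadObj

/-- The free operad on the right `𝕊₂`-module `E`, placed in arity two. -/
def freeOperad : SymOperad.{u, max u v} K where
  obj := FreeOperadObj ρ
  act n :=
    { toFun := fun σ =>
        { toFun := Quotient.map (OperadTerm.act σ.unop) fun _ _ h => OperadRel.act_congr _ h
          map_add' := by rintro ⟨x⟩ ⟨y⟩; exact Quotient.sound (OperadRel.act_add _ x y)
          map_smul' := by rintro c ⟨x⟩; exact Quotient.sound (OperadRel.act_smul _ c x) }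
      map_one' := by
        apply LinearMap.ext
        rintro ⟨x⟩
        exact Quotient.sound (OperadRel.act_one x)
      map_mul' := fun σ τ => by
        apply LinearMap.ext
        rintro ⟨x⟩
        exact Quotient.sound (OperadRel.act_mul τ.unop σ.unop x) }
  comp h i := LinearMap.mk₂ K
    (Quotient.map₂ (OperadTerm.comp h i) fun _ _ e _ _ e' => OperadRel.comp_congr h i e e')
    (by rintro ⟨x⟩ ⟨x'⟩ ⟨y⟩; exact Quotient.sound (OperadRel.comp_add_left h i x x' y))
    (by rintro c ⟨x⟩ ⟨y⟩; exact Quotient.sound (OperadRel.comp_smul_left h i c x y))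
    (by rintro ⟨x⟩ ⟨y⟩ ⟨y'⟩; exact Quotient.sound (OperadRel.comp_add_right h i x y y'))
    (by rintro c ⟨x⟩ ⟨y⟩; exact Quotient.sound (OperadRel.comp_smul_right h i c x y))
  one := Quotient.mk _ OperadTerm.one
  comp_sequential h₁ h₂ h₃ h₄ i j := by
    rintro ⟨x⟩ ⟨y⟩ ⟨z⟩
    exact Quotient.sound (OperadRel.comp_sequential h₁ h₂ h₃ h₄ i j x y z)
  comp_parallel h₁ h₂ h₃ h₄ i k hik := by
    rintro ⟨x⟩ ⟨y⟩ ⟨z⟩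
    exact Quotient.sound (OperadRel.comp_parallel h₁ h₂ h₃ h₄ i k hik x y z)
  equivariance h i σ τ := by
    rintro ⟨x⟩ ⟨y⟩
    exact Quotient.sound (OperadRel.equivariance h i σ τ x y)
  comp_one h i := by
    rintro ⟨x⟩
    exact Quotient.sound (OperadRel.comp_one h i x)
  one_comp h := by
    rintro ⟨x⟩
    exact Quotient.sound (OperadRel.one_comp h x)

/-- The inclusion of the generators. -/
def freeOperadGen : E →ₗ[K] (freeOperad ρ).obj 2 where
  toFun e := (Quotient.mk _ (OperadTerm.gen e) : FreeOperadObj ρ 2)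
  map_add' e e' := Quotient.sound (OperadRel.gen_add e e')
  map_smul' c e := Quotient.sound (OperadRel.gen_smul c e)

theorem freeOperadGen_act (σ : Equiv.Perm (Fin 2)) (e : E) :
    freeOperadGen ρ (ρ (MulOpposite.op σ) e)
      = (freeOperad ρ).act 2 (MulOpposite.op σ) (freeOperadGen ρ e) :=
  Quotient.sound (OperadRel.gen_act σ e)

/-- Evaluation of formal expressions in an operad. -/
def OperadTerm.eval (Q : SymOperad.{u, w} K) (f : E → Q.obj 2) :
    ∀ {n : ℕ}, OperadTerm K E n → Q.obj n
  | _, .zero => 0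
  | _, .add x y => x.eval Q f + y.eval Q f
  | _, .smul c x => c • x.eval Q f
  | _, .one => Q.one
  | _, .gen e => f e
  | _, .act σ x => Q.act _ (MulOpposite.op σ) (x.eval Q f)
  | _, .comp h i x y => Q.comp h i (x.eval Q f) (y.eval Q f)

variable {ρ} in
theorem OperadRel.eval_eq (Q : SymOperad.{u, w} K) (f : E →ₗ[K] Q.obj 2)
    (hf : ∀ σ e, f (ρ (MulOpposite.op σ) e) = Q.act 2 (MulOpposite.op σ) (f e)) {n : ℕ}
    {x y : OperadTerm K E n} (h : OperadRel ρ x y) : x.eval Q f = y.eval Q f := by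
  induction h with
  | refl => rfl
  | symm _ ih => exact ih.symm
  | trans _ _ ih ih' => exact ih.trans ih'
  | add_congr _ _ ih ih' => simp [OperadTerm.eval, ih, ih']
  | smul_congr _ _ ih => simp [OperadTerm.eval, ih]
  | act_congr _ _ ih => simp [OperadTerm.eval, ih]
  | comp_congr _ _ _ _ ih ih' => simp [OperadTerm.eval, ih, ih']
  | add_assoc => simp [OperadTerm.eval, _root_.add_assoc]
  | add_comm => simp [OperadTerm.eval, _root_.add_comm]
  | zero_add => simp [OperadTerm.eval]
  | neg_add => simp [OperadTerm.eval]
  | smul_add => simp [OperadTerm.eval]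
  | add_smul => simp [OperadTerm.eval, _root_.add_smul]
  | mul_smul => simp [OperadTerm.eval, SemigroupAction.mul_smul]
  | one_smul => simp [OperadTerm.eval]
  | act_add => simp [OperadTerm.eval]
  | act_smul => simp [OperadTerm.eval]
  | act_one => simp [OperadTerm.eval]
  | act_mul σ τ x => simp [OperadTerm.eval, MulOpposite.op_mul]
  | comp_add_left => simp [OperadTerm.eval]
  | comp_smul_left => simp [OperadTerm.eval]
  | comp_add_right => simp [OperadTerm.eval]
  | comp_smul_right => simp [OperadTerm.eval]
  | comp_sequential h₁ h₂ h₃ h₄ i j => exact Q.comp_sequential h₁ h₂ h₃ h₄ i j _ _ _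
  | comp_parallel h₁ h₂ h₃ h₄ i k hik => exact Q.comp_parallel h₁ h₂ h₃ h₄ i k hik _ _ _
  | equivariance h i σ τ => exact Q.equivariance h i σ τ _ _
  | comp_one h i => exact Q.comp_one h i _
  | one_comp h => exact Q.one_comp h _
  | gen_add => simp [OperadTerm.eval]
  | gen_smul => simp [OperadTerm.eval]
  | gen_act σ e => exact hf σ e

/-- The universal property of the free operad: an `𝕊`-module morphism from `E`, placed in arity two,
to an operad extends uniquely to a morphism of operads. -/
theorem freeOperad_universal (Q : SymOperad.{u, w} K) (f : E →ₗ[K] Q.obj 2)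
    (hf : ∀ σ e, f (ρ (MulOpposite.op σ) e) = Q.act 2 (MulOpposite.op σ) (f e)) :
    ∃! φ : SymOperad.Hom (freeOperad ρ) Q, ∀ e, φ.app 2 (freeOperadGen ρ e) = f e := by
  refine ⟨
    { app := fun n =>
        { toFun := Quotient.lift (OperadTerm.eval Q f) fun _ _ h => OperadRel.eval_eq Q f hf h
          map_add' := by rintro ⟨x⟩ ⟨y⟩; rfl
          map_smul' := by rintro c ⟨x⟩; rfl }
      map_one := rfl
      map_comp := by rintro m n l h i ⟨x⟩ ⟨y⟩; rfl
      map_act := by rintro n σ ⟨x⟩; rfl }, fun e => rfl, ?_⟩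
  rintro ⟨φ, h1, hc, ha⟩ hφ
  congr
  funext n
  apply LinearMap.ext
  intro q
  obtain ⟨x, rfl⟩ := Quotient.exists_rep (s := operadSetoid ρ n) q
  change φ n (Quotient.mk _ x : FreeOperadObj ρ n) = x.eval Q f
  induction x with
  | zero => exact (φ _).map_zero
  | add x y ihx ihy =>
    rw [OperadTerm.eval, ← ihx, ← ihy]
    exact (φ _).map_add (Quotient.mk _ x : FreeOperadObj ρ _) (Quotient.mk _ y : FreeOperadObj ρ _)
  | smul c x ih =>
    rw [OperadTerm.eval, ← ih]
    exact (φ _).map_smul c (Quotient.mk _ x : FreeOperadObj ρ _)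
  | one => exact h1
  | gen e => exact hφ e
  | act σ x ih =>
    rw [OperadTerm.eval, ← ih]
    exact ha _ σ (Quotient.mk _ x : FreeOperadObj ρ _)
  | comp h i x y ihx ihy =>
    rw [OperadTerm.eval, ← ihx, ← ihy]
    exact hc h i (Quotient.mk _ x : FreeOperadObj ρ _) (Quotient.mk _ y : FreeOperadObj ρ _)

end FreeOperad

/-! ## Operadic ideals, quotients and binary quadratic operads -/

/-- Operadic ideals. -/
structure SymOperad.IdealOf {K : Type u} [Field K] (P : SymOperad.{u, v} K) where
  carrier : ∀ n, Submodule K (P.obj n)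
  act_mem : ∀ {n : ℕ} (σ : Equiv.Perm (Fin n)) {x : P.obj n}, x ∈ carrier n →
    P.act n (MulOpposite.op σ) x ∈ carrier n
  comp_mem_left : ∀ {m n l : ℕ} (h : l + 1 = m + n) (i : Fin m) {x : P.obj m} (y : P.obj n),
    x ∈ carrier m → P.comp h i x y ∈ carrier l
  comp_mem_right : ∀ {m n l : ℕ} (h : l + 1 = m + n) (i : Fin m) (x : P.obj m) {y : P.obj n},
    y ∈ carrier n → P.comp h i x y ∈ carrier l

section Quotient

variable {K : Type u} [Field K] {P : SymOperad.{u, v} K}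

/-- The smallest operadic ideal that contains a given subspace of `P(k)`. -/
def SymOperad.idealSpan (P : SymOperad.{u, v} K) {k : ℕ} (R : Submodule K (P.obj k)) :
    P.IdealOf where
  carrier n := ⨅ (I : P.IdealOf) (_ : R ≤ I.carrier k), I.carrier n
  act_mem σ x hx := by
    simp only [Submodule.mem_iInf] at hx ⊢
    exact fun I hI => I.act_mem σ (hx I hI)
  comp_mem_left h i x y hx := by
    simp only [Submodule.mem_iInf] at hx ⊢
    exact fun I hI => I.comp_mem_left h i y (hx I hI)
  comp_mem_right h i x y hy := by
    simp only [Submodule.mem_iInf] at hy ⊢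
    exact fun I hI => I.comp_mem_right h i x (hy I hI)

/-- The partial compositions of a quotient operad. -/
def SymOperad.IdealOf.quotComp (I : P.IdealOf) {m n l : ℕ} (h : l + 1 = m + n) (i : Fin m) :
    (P.obj m ⧸ I.carrier m) →ₗ[K] (P.obj n ⧸ I.carrier n) →ₗ[K] (P.obj l ⧸ I.carrier l) :=
  (I.carrier m).liftQ
    (LinearMap.flip ((I.carrier n).liftQ
      ((LinearMap.flip (P.comp h i)).compr₂ (I.carrier l).mkQ) (fun y hy => by
        rw [LinearMap.mem_ker]
        ext x
        simpa using I.comp_mem_right h i x hy)))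
    (fun x hx => by
      rw [LinearMap.mem_ker]
      apply Submodule.linearMap_qext
      ext y
      simpa using I.comp_mem_left h i y hx)

/-- The quotient of an operad by an operadic ideal. -/
def SymOperad.IdealOf.quotient (I : P.IdealOf) : SymOperad.{u, v} K where
  obj n := P.obj n ⧸ I.carrier n
  act n :=
    { toFun := fun σ => (I.carrier n).mapQ (I.carrier n) (P.act n σ) fun _ hx =>
        I.act_mem σ.unop hx
      map_one' := by
        apply Submodule.linearMap_qext
        ext x
        simp
      map_mul' := fun σ τ => by
        apply LinearMap.ext
        rintro ⟨x⟩
        exact congrArg Submodule.Quotient.mk (LinearMap.congr_fun ((P.act n).map_mul σ τ) x) }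
  comp h i := I.quotComp h i
  one := Submodule.Quotient.mk P.one
  comp_sequential h₁ h₂ h₃ h₄ i j := by
    rintro ⟨x⟩ ⟨y⟩ ⟨z⟩
    exact congrArg Submodule.Quotient.mk (P.comp_sequential h₁ h₂ h₃ h₄ i j x y z)
  comp_parallel h₁ h₂ h₃ h₄ i k hik := by
    rintro ⟨x⟩ ⟨y⟩ ⟨z⟩
    exact congrArg Submodule.Quotient.mk (P.comp_parallel h₁ h₂ h₃ h₄ i k hik x y z)
  equivariance h i σ τ := by
    rintro ⟨x⟩ ⟨y⟩
    exact congrArg Submodule.Quotient.mk (P.equivariance h i σ τ x y)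
  comp_one h i := by
    rintro ⟨x⟩
    exact congrArg Submodule.Quotient.mk (P.comp_one h i x)
  one_comp h := by
    rintro ⟨x⟩
    exact congrArg Submodule.Quotient.mk (P.one_comp h x)

end Quotient

/-- Binary quadratic data `(E, R)`: a right `𝕊₂`-module `E` and an `𝕊₃`-submodule `R` of
`𝕋(E)(3)`. -/
structure BinaryQuadraticData (K : Type u) [Field K] where
  E : Type v
  [addCommGroup : AddCommGroup E]
  [module : Module K E]
  ρ : Representation K (Equiv.Perm (Fin 2))ᵐᵒᵖ E
  R : Submodule K ((freeOperad ρ).obj 3)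
  act_mem : ∀ (σ : Equiv.Perm (Fin 3)) (r : (freeOperad ρ).obj 3), r ∈ R →
    (freeOperad ρ).act 3 (MulOpposite.op σ) r ∈ R

attribute [instance] BinaryQuadraticData.addCommGroup BinaryQuadraticData.module

/-- The binary quadratic operad `𝕋(E)/(R)`. -/
def BinaryQuadraticData.operad {K : Type u} [Field K] (D : BinaryQuadraticData.{u, v} K) :
    SymOperad.{u, max u v} K := ((freeOperad D.ρ).idealSpan D.R).quotient

/-- The canonical map `E → P(2)` of `P = 𝕋(E)/(R)`. -/
def BinaryQuadraticData.gen {K : Type u} [Field K] (D : BinaryQuadraticData.{u, v} K) :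
    D.E →ₗ[K] D.operad.obj 2 :=
  (((freeOperad D.ρ).idealSpan D.R).carrier 2).mkQ ∘ₗ freeOperadGen D.ρ

/-! ## Universal polynomials and the universal algebra

For the construction only the set of all structure operations matters, so it is written for an
arbitrary set of multilinear operations on `A`. -/

/-- Sets of multilinear operations on `A`, of arbitrary arities. -/
abbrev OperationSet (K : Type u) [Field K] (A : Type w) [AddCommGroup A] [Module K A] :=
  Set (Σ k : ℕ, MultilinearMap K (fun _ : Fin k => A) A)

/-- All structure operations `γ_k(μ)`, `μ ∈ P(k)`, `k ∈ ℕ`, of an algebra over an operad. -/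
def SymOperad.Hom.operations {K : Type u} [Field K] {P : SymOperad.{u, v} K}
    {A : Type w} [AddCommGroup A] [Module K A] (γ : P.AlgebraOn A) : OperationSet K A :=
  {f | ∃ (k : ℕ) (μ : P.obj k), f = ⟨k, γ.op μ⟩}

section Universal

open MvPolynomial

variable {K : Type u} [Field K] {A : Type w} [AddCommGroup A] [Module K A] {n : ℕ}

/-- The structure constant `α^s_{f, i₁, …, i_k}`, the coefficient of the `s`-th basis vector in
`f(a_{i₁}, …, a_{i_k})`. -/
noncomputable def structConst (b : Module.Basis (Fin n) K A) {k : ℕ}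
    (f : MultilinearMap K (fun _ : Fin k => A) A) (s : Fin n) (i : Fin k → Fin n) : K :=
  b.repr (f fun j => b (i j)) s

/-- The universal polynomial
`∑_u α^u_{f,i₁,…,i_k} X_{au} - ∑_{s₁,…,s_k} α^a_{f,s₁,…,s_k} X_{s₁i₁} ⋯ X_{s_ki_k}`. -/
noncomputable def univPoly (b : Module.Basis (Fin n) K A) {k : ℕ}
    (f : MultilinearMap K (fun _ : Fin k => A) A) (a : Fin n) (i : Fin k → Fin n) :
    MvPolynomial (Fin n × Fin n) K :=
  ∑ u, C (structConst b f u i) * X (a, u)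
    - ∑ s : Fin k → Fin n, C (structConst b f a s) * ∏ j, X (s j, i j)

/-- The ideal `J` generated by the universal polynomials of all operations in `F`. -/
noncomputable def univIdeal (b : Module.Basis (Fin n) K A) (F : OperationSet K A) :
    Ideal (MvPolynomial (Fin n × Fin n) K) :=
  Ideal.span {p | ∃ f ∈ F, ∃ (a : Fin n) (i : Fin f.1 → Fin n), p = univPoly b f.2 a i}

/-- The universal algebra `K[X_{si}] / J`. -/
def UnivAlg (b : Module.Basis (Fin n) K A) (F : OperationSet K A) : Type u :=
  MvPolynomial (Fin n × Fin n) K ⧸ univIdeal b F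

noncomputable instance (b : Module.Basis (Fin n) K A) (F : OperationSet K A) :
    CommRing (UnivAlg b F) := inferInstanceAs (CommRing (_ ⧸ univIdeal b F))

noncomputable instance (b : Module.Basis (Fin n) K A) (F : OperationSet K A) :
    Algebra K (UnivAlg b F) := inferInstanceAs (Algebra K (_ ⧸ univIdeal b F))

namespace UnivAlg

variable (b : Module.Basis (Fin n) K A) (F : OperationSet K A)

/-- The quotient map `K[X_{si}] → K[X_{si}] / J`. -/
noncomputable def mk : MvPolynomial (Fin n × Fin n) K →ₐ[K] UnivAlg b F :=
  Ideal.Quotient.mkₐ K (univIdeal b F)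

/-- The class `x_{si}` of `X_{si}`. -/
noncomputable def x (s i : Fin n) : UnivAlg b F := mk b F (X (s, i))

theorem mk_surjective : Function.Surjective (mk b F) := Ideal.Quotient.mkₐ_surjective K _

variable {b F} in
theorem relation {f : Σ k : ℕ, MultilinearMap K (fun _ : Fin k => A) A} (hf : f ∈ F) (a : Fin n)
    (i : Fin f.1 → Fin n) :
    ∑ u, structConst b f.2 u i • x b F a u
      = ∑ s : Fin f.1 → Fin n, structConst b f.2 a s • ∏ j, x b F (s j) (i j) := by
  have h : mk b F (univPoly b f.2 a i) = 0 :=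
    Ideal.Quotient.eq_zero_iff_mem.2 (Ideal.subset_span ⟨f, hf, a, i, rfl⟩)
  rw [univPoly, map_sub, sub_eq_zero, map_sum, map_sum] at h
  simpa [x, ← algebraMap_eq, Algebra.smul_def] using h

variable {b F} in
/-- Algebra morphisms out of the universal algebra. -/
noncomputable def lift {B : Type y} [CommRing B] [Algebra K B] (c : Fin n → Fin n → B)
    (hc : ∀ f ∈ F, ∀ (a : Fin n) (i : Fin f.1 → Fin n),
      ∑ u, structConst b f.2 u i • c a u
        = ∑ s : Fin f.1 → Fin n, structConst b f.2 a s • ∏ j, c (s j) (i j)) :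
    UnivAlg b F →ₐ[K] B :=
  Ideal.Quotient.liftₐ (univIdeal b F) (aeval fun q : Fin n × Fin n => c q.1 q.2) (by
    change ∀ p ∈ univIdeal b F, p ∈ RingHom.ker (aeval fun q : Fin n × Fin n => c q.1 q.2)
    rw [← SetLike.le_def, univIdeal, Ideal.span_le]
    rintro _ ⟨f, hf, a, i, rfl⟩
    have := hc f hf a i
    rw [SetLike.mem_coe, RingHom.mem_ker, univPoly, map_sub, sub_eq_zero, map_sum, map_sum]
    simpa [Algebra.smul_def] using this)

variable {b F} in
@[simp] theorem lift_x {B : Type y} [CommRing B] [Algebra K B] (c : Fin n → Fin n → B)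
    (hc : ∀ f ∈ F, ∀ (a : Fin n) (i : Fin f.1 → Fin n),
      ∑ u, structConst b f.2 u i • c a u
        = ∑ s : Fin f.1 → Fin n, structConst b f.2 a s • ∏ j, c (s j) (i j)) (s i : Fin n) :
    lift c hc (x b F s i) = c s i := by
  change Ideal.Quotient.liftₐ _ _ _ (Ideal.Quotient.mk _ _) = _
  exact MvPolynomial.aeval_X _ _

variable {b F} in
theorem hom_ext {B : Type y} [CommRing B] [Algebra K B] {g g' : UnivAlg b F →ₐ[K] B}
    (h : ∀ s i, g (x b F s i) = g' (x b F s i)) : g = g' := by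
  apply (AlgHom.cancel_right (mk_surjective b F)).1
  apply MvPolynomial.algHom_ext
  rintro ⟨s, i⟩
  exact h s i

theorem tmul_prod {B C ι : Type*} [CommRing B] [Algebra K B] [CommRing C] [Algebra K C]
    (t : Finset ι) (g : ι → B) (g' : ι → C) :
    ∏ j ∈ t, g j ⊗ₜ[K] g' j = (∏ j ∈ t, g j) ⊗ₜ[K] ∏ j ∈ t, g' j := by
  classical
  induction t using Finset.induction_on with
  | empty => simp [Algebra.TensorProduct.one_def]
  | insert j t hj ih => simp [Finset.prod_insert hj, ih]

/-- The comultiplication `Δ(x_{st}) = ∑_r x_{sr} ⊗ x_{rt}`. -/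
noncomputable def comul : UnivAlg b F →ₐ[K] UnivAlg b F ⊗[K] UnivAlg b F :=
  lift (fun s t => ∑ r, x b F s r ⊗ₜ[K] x b F r t) (by
    intro f hf a i
    have hprod : ∀ s : Fin f.1 → Fin n,
        ∏ j, ∑ r, x b F (s j) r ⊗ₜ[K] x b F r (i j)
          = ∑ r : Fin f.1 → Fin n, (∏ j, x b F (s j) (r j)) ⊗ₜ[K] ∏ j, x b F (r j) (i j) := by
      intro s
      rw [Finset.prod_univ_sum, Fintype.piFinset_univ]
      exact Finset.sum_congr rfl fun r _ => tmul_prod _ _ _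
    simp only [hprod]
    calc ∑ u, structConst b f.2 u i • ∑ r, x b F a r ⊗ₜ[K] x b F r u
        = ∑ r, x b F a r ⊗ₜ[K] ∑ u, structConst b f.2 u i • x b F r u := by
          simp only [Finset.smul_sum, TensorProduct.tmul_sum, TensorProduct.tmul_smul]
          exact Finset.sum_comm
      _ = ∑ r, ∑ t : Fin f.1 → Fin n,
            (structConst b f.2 r t • x b F a r) ⊗ₜ[K] ∏ j, x b F (t j) (i j) := by
          simp only [relation hf, TensorProduct.tmul_sum, TensorProduct.tmul_smul,
            TensorProduct.smul_tmul']
      _ = ∑ t : Fin f.1 → Fin n,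
            (∑ r, structConst b f.2 r t • x b F a r) ⊗ₜ[K] ∏ j, x b F (t j) (i j) := by
          simp only [TensorProduct.sum_tmul]
          exact Finset.sum_comm
      _ = _ := by
          simp only [relation hf, TensorProduct.sum_tmul, Finset.smul_sum,
            TensorProduct.smul_tmul']
          exact Finset.sum_comm)

/-- The counit `ε(x_{st}) = δ_{st}`. -/
noncomputable def counit : UnivAlg b F →ₐ[K] K :=
  lift (fun s t => if s = t then 1 else 0) (by
    intro f hf a i
    have hprod : ∀ s : Fin f.1 → Fin n,
        ∏ j, (if s j = i j then (1 : K) else 0) = if s = i then 1 else 0 := by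
      intro s
      rw [Finset.prod_ite_zero]
      simp [funext_iff]
    simp [hprod])

/-- The universal algebra as a bialgebra. -/
noncomputable instance : Bialgebra K (UnivAlg b F) :=
  Bialgebra.ofAlgHom (comul b F) (counit b F)
    (hom_ext fun s i => by
      simp [comul, TensorProduct.tmul_sum, TensorProduct.sum_tmul]
      exact Finset.sum_comm)
    (hom_ext fun s i => by
      simp only [comul, counit, AlgHom.comp_apply, lift_x, map_sum,
        Algebra.TensorProduct.map_tmul, AlgHom.id_apply]
      rw [Finset.sum_eq_single s (fun r _ hr => by simp [hr.symm]) (by simp)]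
      simp)
    (hom_ext fun s i => by
      simp only [comul, counit, AlgHom.comp_apply, lift_x, map_sum,
        Algebra.TensorProduct.map_tmul, AlgHom.id_apply]
      rw [Finset.sum_eq_single i (fun r _ hr => by simp [hr]) (by simp)]
      simp)

/-- The canonical coaction `η(a_i) = ∑_s a_s ⊗ x_{si}`. -/
noncomputable def coaction : A →ₗ[K] A ⊗[K] UnivAlg b F :=
  b.constr K fun i => ∑ s, b s ⊗ₜ[K] x b F s i

end UnivAlg

end Universal

/-! ## Coactions and universal coacting bialgebras and Hopf algebras -/

section Coaction

variable {K : Type u} [Field K] {A : Type w} [AddCommGroup A] [Module K A]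

/-- Multiplication by an element of `H` on the second factor of `A ⊗ H`. -/
noncomputable def scaleRight (A : Type w) [AddCommGroup A] [Module K A] (H : Type v) [CommRing H]
    [Algebra K H] : H →ₗ[K] (A ⊗[K] H →ₗ[K] A ⊗[K] H) :=
  (LinearMap.lTensorHom A) ∘ₗ (LinearMap.mul K H)

/-- The extension of a multilinear operation to `A ⊗ H` for a commutative algebra `H`, determined by
`(a₁ ⊗ c₁, …, a_k ⊗ c_k) ↦ f(a₁, …, a_k) ⊗ c₁ ⋯ c_k`, see `extendOp_tmul`. -/
noncomputable def extendOp (H : Type v) [CommRing H] [Algebra K H] : ∀ k : ℕ,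
    MultilinearMap K (fun _ : Fin k => A) A →ₗ[K]
      MultilinearMap K (fun _ : Fin k => A ⊗[K] H) (A ⊗[K] H)
  | 0 =>
    { toFun := fun f => MultilinearMap.constOfIsEmpty K _ (f 0 ⊗ₜ[K] 1)
      map_add' := fun f g => by ext; simp [TensorProduct.add_tmul]
      map_smul' := fun c f => by ext; simp [TensorProduct.smul_tmul'] }
  | k + 1 =>
    { toFun := fun f => LinearMap.uncurryLeft (TensorProduct.lift (LinearMap.mk₂ K
        (fun (a : A) (c : H) =>
          (scaleRight A H c).compMultilinearMap (extendOp H k (f.curryLeft a)))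
        (fun a a' c => by ext; simp)
        (fun r a c => by ext; simp)
        (fun a c c' => by ext; simp)
        (fun r a c => by ext; simp)))
      map_add' := fun f g => by
        ext v
        simp only [LinearMap.uncurryLeft_apply, add_apply]
        induction v 0 using TensorProduct.induction_on with
        | zero => simp
        | add x y hx hy => simp only [map_add, add_apply, hx, hy]; abel
        | tmul a c => simp [show (f + g).curryLeft a = f.curryLeft a + g.curryLeft a from rfl]
      map_smul' := fun r f => by
        ext v
        simp only [LinearMap.uncurryLeft_apply, smul_apply, RingHom.id_apply]
        induction v 0 using TensorProduct.induction_on with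
        | zero => simp
        | add x y hx hy => simp only [map_add, add_apply, smul_add, hx, hy]
        | tmul a c => simp [show (r • f).curryLeft a = r • f.curryLeft a from rfl] }

@[simp] theorem extendOp_tmul (H : Type v) [CommRing H] [Algebra K H] {k : ℕ}
    (f : MultilinearMap K (fun _ : Fin k => A) A) (a : Fin k → A) (c : Fin k → H) :
    extendOp H k f (fun j => a j ⊗ₜ[K] c j) = f a ⊗ₜ[K] ∏ j, c j := by
  induction k with
  | zero =>
    simp only [extendOp, LinearMap.coe_mk, AddHom.coe_mk, MultilinearMap.constOfIsEmpty_apply,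
      Finset.univ_eq_empty, Finset.prod_empty]
    rw [Subsingleton.elim a 0]
    rfl
  | succ k ih =>
    have h := ih (f.curryLeft (a 0)) (Fin.tail a) (Fin.tail c)
    simp only [extendOp, LinearMap.coe_mk, AddHom.coe_mk, LinearMap.uncurryLeft_apply,
      TensorProduct.lift.tmul, LinearMap.mk₂_apply, LinearMap.compMultilinearMap_apply]
    change scaleRight A H (c 0) (extendOp H k (f.curryLeft (a 0))
      fun j => Fin.tail a j ⊗ₜ[K] Fin.tail c j) = _
    rw [h, MultilinearMap.curryLeft_apply, Fin.cons_self_tail, Fin.prod_univ_succ]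
    simp [scaleRight, Fin.tail]

/-- `ψ : A → A ⊗ H` is a coaction of the bialgebra `H` on `(A, F)`: a right comodule structure that
is compatible with all operations in `F`, i.e. a morphism of algebras from `A` to `A ⊗ H`. -/
structure IsCoaction (F : OperationSet K A) {H : Type v} [CommRing H] [Bialgebra K H]
    (ψ : A →ₗ[K] A ⊗[K] H) : Prop where
  coassoc : (TensorProduct.assoc K A H H).toLinearMap ∘ₗ ψ.rTensor H ∘ₗ ψ
    = (Coalgebra.comul (R := K) (A := H)).lTensor A ∘ₗ ψ
  counit : (TensorProduct.rid K A).toLinearMap ∘ₗ (Coalgebra.counit (R := K) (A := H)).lTensor A ∘ₗ ψ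
    = LinearMap.id
  map_op : ∀ f ∈ F, ∀ a : Fin f.1 → A, ψ (f.2 a) = extendOp H f.1 f.2 (fun j => ψ (a j))

/-- `(H, ψ)` is initial among the commutative bialgebras that coact on `(A, F)`. -/
def IsUniversalCoactingBialgebra (F : OperationSet K A) {H : Type u} [CommRing H] [Bialgebra K H]
    (ψ : A →ₗ[K] A ⊗[K] H) : Prop :=
  IsCoaction F ψ ∧
    ∀ (H' : Type u) [CommRing H'] [Bialgebra K H'] (ψ' : A →ₗ[K] A ⊗[K] H'), IsCoaction F ψ' →
      ∃! φ : H →ₐc[K] H', (φ : H →ₗ[K] H').lTensor A ∘ₗ ψ = ψ'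

/-- `(H, ψ)` is initial among the commutative Hopf algebras that coact on `(A, F)`.  (A bialgebra
morphism of Hopf algebras is a morphism of Hopf algebras.) -/
def IsUniversalCoactingHopfAlgebra (F : OperationSet K A) {H : Type u} [CommRing H]
    [HopfAlgebra K H] (ψ : A →ₗ[K] A ⊗[K] H) : Prop :=
  IsCoaction F ψ ∧
    ∀ (H' : Type u) [CommRing H'] [HopfAlgebra K H'] (ψ' : A →ₗ[K] A ⊗[K] H'), IsCoaction F ψ' →
      ∃! φ : H →ₐc[K] H', (φ : H →ₗ[K] H').lTensor A ∘ₗ ψ = ψ'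

/-- `u : B → H` is the free commutative Hopf algebra on the commutative bialgebra `B`. -/
def IsFreeCommHopfAlgebra {B : Type u} [CommRing B] [Bialgebra K B] {H : Type u} [CommRing H]
    [HopfAlgebra K H] (u : B →ₐc[K] H) : Prop :=
  ∀ (H' : Type u) [CommRing H'] [HopfAlgebra K H'] (g : B →ₐc[K] H'),
    ∃! φ : H →ₐc[K] H', φ.comp u = g

/-- `(H, ψ)` is the free commutative Hopf algebra on the universal algebra `K[X_{si}] / J`, with the
coaction induced by the canonical one. -/
def IsHopfAlgebraOfUnivAlg {n : ℕ} (b : Module.Basis (Fin n) K A) (F : OperationSet K A)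
    {H : Type u} [CommRing H] [HopfAlgebra K H] (ψ : A →ₗ[K] A ⊗[K] H) : Prop :=
  ∃ u : UnivAlg b F →ₐc[K] H, IsFreeCommHopfAlgebra u ∧
    ψ = (u : UnivAlg b F →ₗ[K] H).lTensor A ∘ₗ UnivAlg.coaction b F

/-- Two sets of operations on `A` have the same universal algebra, as an algebra, as a bialgebra and
as a coacting object, and the same universal coacting bialgebras and Hopf algebras. -/
structure SameUniversalConstructions {n : ℕ} (b : Module.Basis (Fin n) K A)
    (F G : OperationSet K A) : Prop where
  ideal_eq : univIdeal b F = univIdeal b G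
  bialgebra_equiv : ∃ e : UnivAlg b F ≃ₐc[K] UnivAlg b G,
    (∀ s i, e (UnivAlg.x b F s i) = UnivAlg.x b G s i) ∧
    (e : UnivAlg b F →ₗ[K] UnivAlg b G).lTensor A ∘ₗ UnivAlg.coaction b F = UnivAlg.coaction b G
  universal_bialgebra : ∀ (H : Type u) [CommRing H] [Bialgebra K H] (ψ : A →ₗ[K] A ⊗[K] H),
    IsUniversalCoactingBialgebra F ψ ↔ IsUniversalCoactingBialgebra G ψ
  hopf_of_univAlg : ∀ (H : Type u) [CommRing H] [HopfAlgebra K H] (ψ : A →ₗ[K] A ⊗[K] H),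
    IsHopfAlgebraOfUnivAlg b F ψ ↔ IsHopfAlgebraOfUnivAlg b G ψ
  universal_hopf : ∀ (H : Type u) [CommRing H] [HopfAlgebra K H] (ψ : A →ₗ[K] A ⊗[K] H),
    IsUniversalCoactingHopfAlgebra F ψ ↔ IsUniversalCoactingHopfAlgebra G ψ

end Coaction

/-! ## The operads `Ass`, `Leib`, `Lie` and `Pois`, and the classical algebras -/

section Classical

variable {K : Type u} [Field K]

section Relations

variable {E : Type v} [AddCommGroup E] [Module K E]
  (ρ : Representation K (Equiv.Perm (Fin 2))ᵐᵒᵖ E)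

/-- `μ ∘₁ ν` in `𝕋(E)(3)`. -/
def comp₁ (x y : E) : (freeOperad ρ).obj 3 :=
  (freeOperad ρ).comp (by norm_num) 0 (freeOperadGen ρ x) (freeOperadGen ρ y)

/-- `μ ∘₂ ν` in `𝕋(E)(3)`. -/
def comp₂ (x y : E) : (freeOperad ρ).obj 3 :=
  (freeOperad ρ).comp (by norm_num) 1 (freeOperadGen ρ x) (freeOperadGen ρ y)

/-- `r^σ` in `𝕋(E)(3)`. -/
def permute (r : (freeOperad ρ).obj 3) (σ : Equiv.Perm (Fin 3)) : (freeOperad ρ).obj 3 :=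
  (freeOperad ρ).act 3 (MulOpposite.op σ) r

/-- The quadratic data `(E, R)` with `R` the `𝕊₃`-submodule generated by a set of relators. -/
def BinaryQuadraticData.ofRelators (S : Set ((freeOperad ρ).obj 3)) :
    BinaryQuadraticData.{u, v} K where
  E := E
  ρ := ρ
  R := Submodule.span K {t | ∃ r ∈ S, ∃ σ, t = permute ρ r σ}
  act_mem σ r hr := by
    induction hr using Submodule.span_induction with
    | mem x hx =>
      obtain ⟨r, hr, τ, rfl⟩ := hx
      refine Submodule.subset_span ⟨r, hr, τ * σ, ?_⟩
      simp [permute]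
    | zero => simp
    | add x y _ _ hx hy => rw [map_add]; exact add_mem hx hy
    | smul c x _ hx => rw [map_smul]; exact Submodule.smul_mem _ _ hx

end Relations

variable (K)

/-- The right regular `𝕊₂`-module `K[𝕊₂]`. -/
noncomputable def regularModule : Representation K (Equiv.Perm (Fin 2))ᵐᵒᵖ
    (MonoidAlgebra K (Equiv.Perm (Fin 2))) where
  toFun σ := LinearMap.mulRight K (MonoidAlgebra.of K _ σ.unop)
  map_one' := by ext; simp
  map_mul' σ τ := by
    apply LinearMap.ext
    intro x
    simp [mul_assoc]

/-- The sign `𝕊₂`-module `K c`, `c^{(12)} = -c`. -/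
noncomputable def signModule : Representation K (Equiv.Perm (Fin 2))ᵐᵒᵖ K where
  toFun σ := LinearMap.lsmul K K ((Equiv.Perm.sign σ.unop : ℤ) : K)
  map_one' := by ext; simp
  map_mul' σ τ := by ext; simp [mul_comm]

/-- The `𝕊₂`-module `K c ⊕ K μ`, with the sign action on `K c` and the trivial one on `K μ`. -/
noncomputable def signTrivialModule : Representation K (Equiv.Perm (Fin 2))ᵐᵒᵖ (K × K) where
  toFun σ := (signModule K σ).prodMap LinearMap.id
  map_one' := by ext <;> simp
  map_mul' σ τ := by ext <;> simp

/-- The generator `μ = id` of `K[𝕊₂]`. -/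
noncomputable abbrev regularGen : MonoidAlgebra K (Equiv.Perm (Fin 2)) := 1

/-- `Ass`: one operation `μ` without symmetry, relator `μ ∘₁ μ - μ ∘₂ μ`. -/
noncomputable def assData : BinaryQuadraticData.{u, u} K :=
  .ofRelators (regularModule K)
    {comp₁ (regularModule K) (regularGen K) (regularGen K)
      - comp₂ (regularModule K) (regularGen K) (regularGen K)}

/-- `Leib`: one operation `μ` without symmetry, relator `μ ∘₁ μ - μ ∘₂ μ - (μ ∘₁ μ)^{(23)}`. -/
noncomputable def leibData : BinaryQuadraticData.{u, u} K :=
  .ofRelators (regularModule K)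
    {comp₁ (regularModule K) (regularGen K) (regularGen K)
      - comp₂ (regularModule K) (regularGen K) (regularGen K)
      - permute (regularModule K) (comp₁ (regularModule K) (regularGen K) (regularGen K))
          (Equiv.swap 1 2)}

/-- `Lie`: one antisymmetric operation `c`, relator `c ∘₁ c + (c ∘₁ c)^{(123)} + (c ∘₁ c)^{(132)}`. -/
noncomputable def lieData : BinaryQuadraticData.{u, u} K :=
  .ofRelators (signModule K)
    {comp₁ (signModule K) 1 1
      + permute (signModule K) (comp₁ (signModule K) 1 1) (finRotate 3)
      + permute (signModule K) (comp₁ (signModule K) 1 1) (finRotate 3)⁻¹}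

/-- `Pois`: an antisymmetric operation `c = (1, 0)` and a symmetric operation `μ = (0, 1)`; the
relators are those of `Lie` and `Com` and `c ∘₁ μ - (μ ∘₁ c)^{(23)} - μ ∘₂ c`. -/
noncomputable def poisData : BinaryQuadraticData.{u, u} K :=
  .ofRelators (signTrivialModule K)
    {comp₁ (signTrivialModule K) (1, 0) (1, 0)
        + permute (signTrivialModule K) (comp₁ (signTrivialModule K) (1, 0) (1, 0)) (finRotate 3)
        + permute (signTrivialModule K) (comp₁ (signTrivialModule K) (1, 0) (1, 0))
            (finRotate 3)⁻¹,
      comp₁ (signTrivialModule K) (0, 1) (0, 1) - comp₂ (signTrivialModule K) (0, 1) (0, 1),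
      comp₁ (signTrivialModule K) (1, 0) (0, 1)
        - permute (signTrivialModule K) (comp₁ (signTrivialModule K) (0, 1) (1, 0))
            (Equiv.swap 1 2)
        - comp₂ (signTrivialModule K) (0, 1) (1, 0)}

/-- The operation `μ ∈ Ass(2)`. -/
noncomputable def assMul : (assData K).operad.obj 2 := (assData K).gen (regularGen K)

/-- The operation `μ ∈ Leib(2)`. -/
noncomputable def leibBracket : (leibData K).operad.obj 2 := (leibData K).gen (regularGen K)

/-- The operation `c ∈ Lie(2)`. -/
noncomputable def lieBracket : (lieData K).operad.obj 2 := (lieData K).gen (1 : K)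

/-- The operation `c ∈ Pois(2)`. -/
noncomputable def poisBracket : (poisData K).operad.obj 2 := (poisData K).gen ((1, 0) : K × K)

/-- The operation `μ ∈ Pois(2)`. -/
noncomputable def poisMul : (poisData K).operad.obj 2 := (poisData K).gen ((0, 1) : K × K)

variable {K} {A : Type w} [AddCommGroup A] [Module K A]

/-- Products of (non-unital) associative algebras. -/
def IsAssociativeProduct (m : MultilinearMap K (fun _ : Fin 2 => A) A) : Prop :=
  ∀ x y z, m ![m ![x, y], z] = m ![x, m ![y, z]]

/-- Brackets of (right) Leibniz algebras. -/
def IsLeibnizBracket (m : MultilinearMap K (fun _ : Fin 2 => A) A) : Prop :=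
  ∀ x y z, m ![m ![x, y], z] = m ![x, m ![y, z]] + m ![m ![x, z], y]

/-- Brackets of Lie algebras. -/
def IsLieBracket (m : MultilinearMap K (fun _ : Fin 2 => A) A) : Prop :=
  (∀ x, m ![x, x] = 0) ∧
    ∀ x y z, m ![m ![x, y], z] + m ![m ![y, z], x] + m ![m ![z, x], y] = 0

/-- Poisson algebras: a Lie bracket `c` and a commutative associative product `m` such that the
bracket is a derivation in each argument. -/
def IsPoissonPair (c m : MultilinearMap K (fun _ : Fin 2 => A) A) : Prop :=
  IsLieBracket c ∧ IsAssociativeProduct m ∧ (∀ x y, m ![x, y] = m ![y, x]) ∧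
    ∀ x y z, c ![m ![x, y], z] = m ![c ![x, z], y] + m ![x, c ![y, z]]

open MvPolynomial in
/-- The polynomial `∑_u α^u_{ij} X_{au} - ∑_{s,t} α^a_{st} X_{si} X_{tj}` of a bilinear operation
with structure constants `α`. -/
noncomputable def binaryPoly {n : ℕ} (b : Module.Basis (Fin n) K A)
    (m : MultilinearMap K (fun _ : Fin 2 => A) A) (a i j : Fin n) :
    MvPolynomial (Fin n × Fin n) K :=
  ∑ u, C (b.repr (m ![b i, b j]) u) * X (a, u)
    - ∑ s, ∑ t, C (b.repr (m ![b s, b t]) a) * X (s, i) * X (t, j)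

/-- The universal constructions for algebras over a binary operad `P` with one distinguished
operation `μ` agree with those for vector spaces with a bilinear operation that satisfies `Law`:
`P`-algebra structures are the same as such operations, via `μ`, and the ideal, the universal
algebra and the universal coacting bialgebras and Hopf algebras of a `P`-algebra are those
constructed from that bilinear operation alone. -/
def AgreesWithClassical {n : ℕ} (b : Module.Basis (Fin n) K A) (P : SymOperad.{u, v} K)
    (μ : P.obj 2) (Law : MultilinearMap K (fun _ : Fin 2 => A) A → Prop) : Prop :=
  (∀ m, Law m → ∃! γ : P.AlgebraOn A, γ.op μ = m) ∧
    ∀ γ : P.AlgebraOn A, Law (γ.op μ) ∧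
      univIdeal b γ.operations = Ideal.span {p | ∃ a i j, p = binaryPoly b (γ.op μ) a i j} ∧
      SameUniversalConstructions b γ.operations {⟨2, γ.op μ⟩}

end Classical

/-!
# Universal algebras of algebras over a binary quadratic operad

The argument rests on one observation.  Let `ψ : A → A ⊗ H` be a linear map into the extension of
`A` by a commutative algebra `H`.  Extending operations from `A` to `A ⊗ H` respects units,
permutations and partial compositions (`extendOp_one`, `extendOp_domDomCongr`, `extendOp_endComp`),
so the operations on `A` that are compatible with `ψ` form a suboperad of the endomorphism operad
(`compatibleOps`).  If the generating operations of an algebra over `𝕋(E)/(R)` are compatible with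
`ψ`, all its operations are (`BinaryQuadraticData.op_mem_compatibleSubmodule`).

If `ψ` is given by a matrix `c` over `H`, compatibility of `f` with `ψ` says that the universal
polynomials of `f` vanish at `c` (`matrixMap_compatible_iff`).  For the generic matrix modulo an
ideal `I`, it says that `I` contains these polynomials, so the ideal `J` is determined by the
generating operations.  The axioms of a coaction involve the operations only through the same
compatibility condition, so the coacting bialgebras and Hopf algebras, and the universal ones among
them, depend only on the generating operations as well
(`SameCompatibleMaps.sameUniversalConstructions`).

That `E → P(2)` is onto follows because a suboperad containing the generators is everything, and
such a suboperad is obtained from `0`, `K · 1` and the image of `E` in arities `0`, `1` and `2`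
(`SymOperad.SubOperad.ofArityTwo`).  It is injective because `E` acts faithfully on `(K × K) × E`
by bilinear operations whose composites all vanish (`nilpotentOp`): these satisfy any quadratic
relations.

For the classical operads, an algebra structure is the same as an equivariant family of bilinear
operations, parametrized by `E`, for which the relators vanish (`exists_algebra_of_relators`,
`exists_free_algebra`, `algebra_ext`).  Evaluating the relators gives the classical laws.
Characteristic zero is used to pass from an antisymmetric bracket to an alternating one.
-/

/-! ### Suboperads, ideals and quotients of operads -/

/-- A suboperad of `P`: subspaces of the `P(n)` that contain the unit and are stable under
permutations and partial compositions. -/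
structure SymOperad.SubOperad {K : Type u} [Field K] (P : SymOperad.{u, v} K) where
  carrier : ∀ n, Submodule K (P.obj n)
  one_mem : P.one ∈ carrier 1
  act_mem : ∀ {n : ℕ} (σ : Equiv.Perm (Fin n)) {x : P.obj n}, x ∈ carrier n →
    P.act n (MulOpposite.op σ) x ∈ carrier n
  comp_mem : ∀ {m n l : ℕ} (h : l + 1 = m + n) (i : Fin m) {x : P.obj m} {y : P.obj n},
    x ∈ carrier m → y ∈ carrier n → P.comp h i x y ∈ carrier l

section Suboperads

variable {K : Type u} [Field K]

@[ext] theorem SymOperad.Hom.ext {P : SymOperad.{u, v} K} {Q : SymOperad.{u, w} K}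
    {φ ψ : SymOperad.Hom P Q} (h : ∀ n x, φ.app n x = ψ.app n x) : φ = ψ := by
  obtain ⟨f, _, _, _⟩ := φ
  obtain ⟨g, _, _, _⟩ := ψ
  obtain rfl : f = g := funext fun n => LinearMap.ext (h n)
  rfl

/-- Composition of morphisms of operads. -/
def SymOperad.Hom.comp {P : SymOperad.{u, v} K} {Q : SymOperad.{u, w} K} {T : SymOperad.{u, y} K}
    (ψ : SymOperad.Hom Q T) (φ : SymOperad.Hom P Q) : SymOperad.Hom P T where
  app n := ψ.app n ∘ₗ φ.app n
  map_one := by simp [φ.map_one, ψ.map_one]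
  map_comp h i x y := by simp [φ.map_comp, ψ.map_comp]
  map_act n σ x := by simp [φ.map_act, ψ.map_act]

/-- The suboperad on which two morphisms of operads agree. -/
def SymOperad.Hom.eqLocus {P : SymOperad.{u, v} K} {Q : SymOperad.{u, w} K}
    (φ ψ : SymOperad.Hom P Q) : P.SubOperad where
  carrier n := LinearMap.eqLocus (φ.app n) (ψ.app n)
  one_mem := by simp [φ.map_one, ψ.map_one]
  act_mem σ x hx := by
    rw [LinearMap.mem_eqLocus] at hx ⊢
    rw [φ.map_act, ψ.map_act, hx]
  comp_mem h i x y hx hy := by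
    rw [LinearMap.mem_eqLocus] at hx hy ⊢
    rw [φ.map_comp, ψ.map_comp, hx, hy]

/-- The preimage of a suboperad under a morphism of operads. -/
def SymOperad.SubOperad.comap {P : SymOperad.{u, v} K} {Q : SymOperad.{u, w} K}
    (S : Q.SubOperad) (φ : SymOperad.Hom P Q) : P.SubOperad where
  carrier n := (S.carrier n).comap (φ.app n)
  one_mem := by simpa [φ.map_one] using S.one_mem
  act_mem σ x hx := by
    rw [Submodule.mem_comap] at hx ⊢
    rw [φ.map_act]
    exact S.act_mem σ hx
  comp_mem h i x y hx hy := by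
    rw [Submodule.mem_comap] at hx hy ⊢
    rw [φ.map_comp]
    exact S.comp_mem h i hx hy

/-- The kernel of a morphism of operads. -/
def SymOperad.Hom.ker {P : SymOperad.{u, v} K} {Q : SymOperad.{u, w} K}
    (φ : SymOperad.Hom P Q) : P.IdealOf where
  carrier n := LinearMap.ker (φ.app n)
  act_mem σ x hx := by
    rw [LinearMap.mem_ker] at hx ⊢
    rw [φ.map_act, hx, map_zero]
  comp_mem_left h i x y hx := by
    rw [LinearMap.mem_ker] at hx ⊢
    rw [φ.map_comp, hx, map_zero, LinearMap.zero_apply]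
  comp_mem_right h i x y hy := by
    rw [LinearMap.mem_ker] at hy ⊢
    rw [φ.map_comp, hy, map_zero]

theorem SymOperad.le_idealSpan {P : SymOperad.{u, v} K} {k : ℕ} (R : Submodule K (P.obj k)) :
    R ≤ (P.idealSpan R).carrier k :=
  le_iInf₂ fun _ h => h

theorem SymOperad.idealSpan_le {P : SymOperad.{u, v} K} {k : ℕ} {R : Submodule K (P.obj k)}
    {I : P.IdealOf} (h : R ≤ I.carrier k) (n : ℕ) : (P.idealSpan R).carrier n ≤ I.carrier n :=
  iInf₂_le I h

/-- The projection onto a quotient operad. -/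
def SymOperad.IdealOf.proj {P : SymOperad.{u, v} K} (I : P.IdealOf) :
    SymOperad.Hom P I.quotient where
  app n := (I.carrier n).mkQ
  map_one := rfl
  map_comp _ _ _ _ := rfl
  map_act _ _ _ := rfl

theorem SymOperad.IdealOf.proj_surjective {P : SymOperad.{u, v} K} (I : P.IdealOf) (n : ℕ) :
    Function.Surjective (I.proj.app n) :=
  Submodule.mkQ_surjective _

/-- A morphism of operads that kills an ideal descends to the quotient. -/
def SymOperad.IdealOf.lift {P : SymOperad.{u, v} K} {Q : SymOperad.{u, w} K} (I : P.IdealOf)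
    (φ : SymOperad.Hom P Q) (h : ∀ n, I.carrier n ≤ LinearMap.ker (φ.app n)) :
    SymOperad.Hom I.quotient Q where
  app n := (I.carrier n).liftQ (φ.app n) (h n)
  map_one := φ.map_one
  map_comp := by
    rintro m n l hl i ⟨x⟩ ⟨y⟩
    exact φ.map_comp hl i x y
  map_act := by
    rintro n σ ⟨x⟩
    exact φ.map_act n σ x

/-- A suboperad of the free operad that contains the generators is everything. -/
theorem freeOperad_induction {E : Type v} [AddCommGroup E] [Module K E]
    (ρ : Representation K (Equiv.Perm (Fin 2))ᵐᵒᵖ E) (S : (freeOperad ρ).SubOperad)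
    (h : ∀ e, freeOperadGen ρ e ∈ S.carrier 2) (n : ℕ) (x : (freeOperad ρ).obj n) :
    x ∈ S.carrier n := by
  obtain ⟨t, rfl⟩ := Quotient.exists_rep (s := operadSetoid ρ n) x
  induction t with
  | zero => exact (S.carrier _).zero_mem
  | add x y ihx ihy => exact (S.carrier _).add_mem ihx ihy
  | smul c x ih => exact (S.carrier _).smul_mem c ih
  | one => exact S.one_mem
  | gen e => exact h e
  | act σ x ih => exact S.act_mem σ ih
  | comp h i x y ihx ihy => exact S.comp_mem h i ihx ihy

/-- The projection `𝕋(E) → 𝕋(E)/(R)`. -/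
def BinaryQuadraticData.proj (D : BinaryQuadraticData.{u, v} K) :
    SymOperad.Hom (freeOperad D.ρ) D.operad :=
  ((freeOperad D.ρ).idealSpan D.R).proj

theorem BinaryQuadraticData.proj_surjective (D : BinaryQuadraticData.{u, v} K) (n : ℕ) :
    Function.Surjective (D.proj.app n) :=
  SymOperad.IdealOf.proj_surjective _ n

theorem BinaryQuadraticData.proj_gen (D : BinaryQuadraticData.{u, v} K) (e : D.E) :
    D.proj.app 2 (freeOperadGen D.ρ e) = D.gen e := rfl

theorem BinaryQuadraticData.proj_eq_zero (D : BinaryQuadraticData.{u, v} K)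
    {r : (freeOperad D.ρ).obj 3} (hr : r ∈ D.R) : D.proj.app 3 r = 0 :=
  (Submodule.Quotient.mk_eq_zero _).2 (SymOperad.le_idealSpan D.R hr)

theorem BinaryQuadraticData.gen_act (D : BinaryQuadraticData.{u, v} K)
    (σ : Equiv.Perm (Fin 2)) (e : D.E) :
    D.gen (D.ρ (MulOpposite.op σ) e) = D.operad.act 2 (MulOpposite.op σ) (D.gen e) := by
  rw [← D.proj_gen, freeOperadGen_act, D.proj.map_act, D.proj_gen]

/-- A suboperad of `𝕋(E)/(R)` that contains the generators is everything. -/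
theorem BinaryQuadraticData.induction (D : BinaryQuadraticData.{u, v} K) (S : D.operad.SubOperad)
    (h : ∀ e, D.gen e ∈ S.carrier 2) (n : ℕ) (x : D.operad.obj n) : x ∈ S.carrier n := by
  obtain ⟨x, rfl⟩ := D.proj_surjective n x
  exact freeOperad_induction D.ρ (S.comap D.proj) h n x

theorem BinaryQuadraticData.hom_ext (D : BinaryQuadraticData.{u, v} K) {Q : SymOperad.{u, w} K}
    {φ ψ : SymOperad.Hom D.operad Q} (h : ∀ e, φ.app 2 (D.gen e) = ψ.app 2 (D.gen e)) : φ = ψ :=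
  SymOperad.Hom.ext fun n x => D.induction (φ.eqLocus ψ) h n x

/-- The universal property of `𝕋(E)/(R)`, existence part. -/
theorem BinaryQuadraticData.exists_hom (D : BinaryQuadraticData.{u, v} K) {Q : SymOperad.{u, w} K}
    (f : D.E →ₗ[K] Q.obj 2)
    (hf : ∀ σ e, f (D.ρ (MulOpposite.op σ) e) = Q.act 2 (MulOpposite.op σ) (f e))
    (hR : ∀ φ : SymOperad.Hom (freeOperad D.ρ) Q, (∀ e, φ.app 2 (freeOperadGen D.ρ e) = f e) →
      ∀ r ∈ D.R, φ.app 3 r = 0) :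
    ∃ φ : SymOperad.Hom D.operad Q, ∀ e, φ.app 2 (D.gen e) = f e := by
  obtain ⟨φ, hφ, -⟩ := freeOperad_universal D.ρ Q f hf
  exact ⟨((freeOperad D.ρ).idealSpan D.R).lift φ (SymOperad.idealSpan_le (I := φ.ker) (hR φ hφ)), hφ⟩

/-! ### The arity two part of a binary quadratic operad -/

/-- The suboperad that is zero in arity `0`, the line spanned by the unit in arity `1`, a given
`𝕊₂`-submodule `M` in arity `2` and a given ideal `L` in arities `≥ 3`. -/
def SymOperad.SubOperad.ofArityTwo (P : SymOperad.{u, v} K) (M : Submodule K (P.obj 2))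
    (L : P.IdealOf) (hM : ∀ (σ : Equiv.Perm (Fin 2)), ∀ x ∈ M, P.act 2 (MulOpposite.op σ) x ∈ M)
    (hL : ∀ (h : 3 + 1 = 2 + 2) (i : Fin 2), ∀ x ∈ M, ∀ y ∈ M, P.comp h i x y ∈ L.carrier 3) :
    P.SubOperad where
  carrier
    | 0 => ⊥
    | 1 => K ∙ P.one
    | 2 => M
    | n + 3 => L.carrier (n + 3)
  one_mem := Submodule.mem_span_singleton_self _
  act_mem := by
    rintro (_ | _ | _ | n) σ x hx
    · rw [(Submodule.mem_bot K).1 hx, map_zero]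
      exact Submodule.zero_mem _
    · obtain rfl : σ = 1 := Subsingleton.elim (α := Equiv.Perm (Fin 1)) _ _
      rw [MulOpposite.op_one, map_one]
      exact hx
    · exact hM σ x hx
    · exact L.act_mem σ hx
  comp_mem := by
    intro m n l h i x y hx hy
    rcases n with _ | _ | n
    · rw [(Submodule.mem_bot K).1 hy, map_zero]
      exact Submodule.zero_mem _
    · obtain rfl : l = m := by omega
      obtain ⟨c, rfl⟩ := Submodule.mem_span_singleton.1 hy
      rw [map_smul, P.comp_one]
      exact Submodule.smul_mem _ c hx
    · rcases m with _ | _ | m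
      · exact i.elim0
      · obtain rfl : l = n + 2 := by omega
        obtain ⟨c, rfl⟩ := Submodule.mem_span_singleton.1 hx
        obtain rfl : i = 0 := Subsingleton.elim (α := Fin 1) _ _
        rw [map_smul, LinearMap.smul_apply, P.one_comp]
        exact Submodule.smul_mem _ c hy
      · obtain ⟨k, rfl⟩ : ∃ k, l = k + 3 := ⟨l - 3, by omega⟩
        rcases m with _ | m
        · rcases n with _ | n
          · obtain rfl : k = 0 := by omega
            exact hL h i x hx y hy
          · exact L.comp_mem_right h i x hy
        · exact L.comp_mem_left h i y hx

variable (D : BinaryQuadraticData.{u, v} K)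

/-- The elements of `P(n)` that are `0` for `n = 0`, multiples of the unit for `n = 1`, in the image
of `E` for `n = 2` and arbitrary for `n ≥ 3` form a suboperad that contains the generators. -/
theorem BinaryQuadraticData.gen_surjective : Function.Surjective D.gen :=
  D.induction
    (.ofArityTwo D.operad (LinearMap.range D.gen)
      { carrier := fun _ => ⊤
        act_mem := by simp
        comp_mem_left := by simp
        comp_mem_right := by simp }
      (by
        rintro σ _ ⟨e, rfl⟩
        exact ⟨_, D.gen_act σ e⟩)
      (by simp))
    (fun e => ⟨e, rfl⟩) 2

/-- For a right `𝕊₂`-module `E`, the operation `((s, t), _), ((s', t'), _) ↦ s t' e + t s' e^{(12)}`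
on `(K × K) × E`, with values in `E`.  It determines `e`, depends equivariantly on `e`, and all
composites of two such operations vanish. -/
noncomputable def nilpotentOp {E : Type v} [AddCommGroup E] [Module K E]
    (ρ : Representation K (Equiv.Perm (Fin 2))ᵐᵒᵖ E) :
    E →ₗ[K] MultilinearMap K (fun _ : Fin 2 => (K × K) × E) ((K × K) × E) where
  toFun e := MultilinearMap.mk'
    (fun v => (0, ((v 0).1.1 * (v 1).1.2) • e
      + ((v 0).1.2 * (v 1).1.1) • ρ (MulOpposite.op (Equiv.swap 0 1)) e))
    (by
      intro v i x y
      fin_cases i <;> simp [add_mul, mul_add, add_smul] <;> abel)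
    (by
      intro v i c x
      fin_cases i <;> simp [mul_assoc, mul_left_comm, mul_smul, smul_add])
  map_add' e e' := by
    ext v <;> simp
    abel
  map_smul' c e := by
    ext v <;> simp [smul_add, smul_comm c]

theorem nilpotentOp_apply {E : Type v} [AddCommGroup E] [Module K E]
    (ρ : Representation K (Equiv.Perm (Fin 2))ᵐᵒᵖ E) (e : E) (v : Fin 2 → (K × K) × E) :
    nilpotentOp ρ e v = (0, ((v 0).1.1 * (v 1).1.2) • e
      + ((v 0).1.2 * (v 1).1.1) • ρ (MulOpposite.op (Equiv.swap 0 1)) e) := rfl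

theorem perm_fin_two_eq (σ : Equiv.Perm (Fin 2)) : σ = 1 ∨ σ = Equiv.swap 0 1 := by
  revert σ
  decide

theorem nilpotentOp_act {E : Type v} [AddCommGroup E] [Module K E]
    (ρ : Representation K (Equiv.Perm (Fin 2))ᵐᵒᵖ E) (σ : Equiv.Perm (Fin 2)) (e : E) :
    nilpotentOp ρ (ρ (MulOpposite.op σ) e)
      = (endOperad K ((K × K) × E)).act 2 (MulOpposite.op σ) (nilpotentOp ρ e) := by
  apply MultilinearMap.ext
  intro v
  change _ = nilpotentOp ρ e fun i => v (σ⁻¹ i)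
  rcases perm_fin_two_eq σ with rfl | rfl
  · rw [MulOpposite.op_one, map_one]
    rfl
  · have h : ρ (MulOpposite.op (Equiv.swap 0 1)) (ρ (MulOpposite.op (Equiv.swap 0 1)) e) = e := by
      rw [← Module.End.mul_apply, ← map_mul, ← MulOpposite.op_mul, Equiv.swap_mul_self]
      simp
    rw [nilpotentOp_apply, h, add_comm, mul_comm (v 0).1.1, mul_comm (v 0).1.2]
    rfl

theorem nilpotentOp_comp {E : Type v} [AddCommGroup E] [Module K E]
    (ρ : Representation K (Equiv.Perm (Fin 2))ᵐᵒᵖ E) (h : 3 + 1 = 2 + 2) (i : Fin 2) (e e' : E) :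
    (endOperad K ((K × K) × E)).comp h i (nilpotentOp ρ e) (nilpotentOp ρ e') = 0 := by
  apply MultilinearMap.ext
  intro v
  change nilpotentOp ρ e (outerInput h i (nilpotentOp ρ e') v) = 0
  have h0 : (outerInput h i (nilpotentOp ρ e') v i).1 = 0 := by
    rw [outerInput_self, nilpotentOp_apply]
  rw [nilpotentOp_apply]
  fin_cases i <;> simp at h0 <;> simp [h0]

/-- The operations `nilpotentOp` satisfy all quadratic relations, since everything in arity `3` of
the free operad acts by zero; so they define an algebra over `𝕋(E)/(R)` on which `E` acts
faithfully. -/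
theorem BinaryQuadraticData.gen_injective : Function.Injective D.gen := by
  obtain ⟨φ, hφ⟩ := D.exists_hom (Q := endOperad K ((K × K) × D.E)) (nilpotentOp D.ρ)
    (nilpotentOp_act D.ρ) (by
      intro φ hφ r _
      refine (Submodule.mem_bot K).1 (freeOperad_induction D.ρ (SymOperad.SubOperad.comap
        (.ofArityTwo (endOperad K ((K × K) × D.E)) (LinearMap.range (nilpotentOp D.ρ))
          { carrier := fun _ => ⊥
            act_mem := by simp +contextual
            comp_mem_left := by simp +contextual
            comp_mem_right := by simp +contextual } ?_ ?_) φ) ?_ 3 r)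
      · rintro σ _ ⟨e, rfl⟩
        exact ⟨_, nilpotentOp_act D.ρ σ e⟩
      · rintro h i _ ⟨e, rfl⟩ _ ⟨e', rfl⟩
        exact (Submodule.mem_bot K).2 (nilpotentOp_comp D.ρ h i e e')
      · exact fun e => ⟨e, (hφ e).symm⟩)
  intro e e' h
  have h' : nilpotentOp D.ρ e = nilpotentOp D.ρ e' :=
    (hφ e).symm.trans ((congrArg (φ.app 2) h).trans (hφ e'))
  -- the value at `((1, 0), 0)` and `((0, 1), 0)` is `(0, e)`
  have := congrArg Prod.snd (DFunLike.congr_fun h' ![((1, 0), 0), ((0, 1), 0)])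
  simpa [nilpotentOp_apply] using this

end Suboperads

/-! ### Operations compatible with a map `A → A ⊗ H` -/

section Compatible

variable {K : Type u} [Field K] {A : Type w} [AddCommGroup A] [Module K A]
  {n : ℕ} (H : Type v) [CommRing H] [Algebra K H]

variable {H} in
/-- Multilinear maps on `A ⊗ H` are determined by their values on pure tensors. -/
theorem multilinearMap_tensor_ext (b : Module.Basis (Fin n) K A)
    {k : ℕ} {M : Type*} [AddCommGroup M] [Module K M]
    {f g : MultilinearMap K (fun _ : Fin k => A ⊗[K] H) M}
    (h : ∀ (a : Fin k → A) (c : Fin k → H),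
      f (fun j => a j ⊗ₜ[K] c j) = g (fun j => a j ⊗ₜ[K] c j)) : f = g := by
  refine Module.Basis.ext_multilinear
    (fun _ => b.tensorProduct (Module.Basis.ofVectorSpace K H)) fun v => ?_
  simpa only [Module.Basis.tensorProduct_apply'] using h _ _

theorem extendOp_one (b : Module.Basis (Fin n) K A) :
    extendOp H 1 (MultilinearMap.ofSubsingleton K A A (0 : Fin 1) LinearMap.id)
    = MultilinearMap.ofSubsingleton K (A ⊗[K] H) (A ⊗[K] H) (0 : Fin 1) LinearMap.id := by
  refine multilinearMap_tensor_ext b fun a c => ?_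
  rw [extendOp_tmul]
  simp

theorem extendOp_domDomCongr (b : Module.Basis (Fin n) K A) {k : ℕ} (σ : Equiv.Perm (Fin k))
    (f : MultilinearMap K (fun _ : Fin k => A) A) :
    extendOp H k (f.domDomCongr σ) = (extendOp H k f).domDomCongr σ := by
  refine multilinearMap_tensor_ext b fun a c => ?_
  rw [extendOp_tmul, MultilinearMap.domDomCongr_apply, MultilinearMap.domDomCongr_apply,
    extendOp_tmul, Equiv.prod_comp σ c]

theorem extendOp_endComp (b : Module.Basis (Fin n) K A) {k m l : ℕ} (h : l + 1 = k + m) (i : Fin k)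
    (f : MultilinearMap K (fun _ : Fin k => A) A) (g : MultilinearMap K (fun _ : Fin m => A) A) :
    extendOp H l (endComp h i f g) = endComp h i (extendOp H k f) (extendOp H m g) := by
  refine multilinearMap_tensor_ext b fun a c => ?_
  have hin : outerInput h i (extendOp H m g) (fun j => a j ⊗ₜ[K] c j)
      = fun j => outerInput h i g a j ⊗ₜ[K] outerInput h i (fun d => ∏ t, d t) c j := by
    refine outerInput_eq h i _ _ _ ?_ fun j hj => ?_
    · rw [outerInput_self, outerInput_self, extendOp_tmul]
    · rw [outerInput_of_ne h i _ _ hj, outerInput_of_ne h i _ _ hj]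
  rw [extendOp_tmul, endComp_apply, endComp_apply, hin, extendOp_tmul]
  congr 1
  -- split the product over all inputs into the inputs of `f` and those of `g`
  rw [← (slotEquiv h i).prod_comp, Fintype.prod_sum_type,
    ← Fintype.prod_subtype_mul_prod_subtype (fun j => j ≠ i)]
  congr 1
  · refine Finset.prod_congr rfl fun j _ => ?_
    rw [outerInput_of_ne h i _ _ j.2]
    rfl
  · rw [Fintype.prod_eq_single (⟨i, by simp⟩ : {j // ¬ j ≠ i})
      (fun j hj => (hj (Subtype.ext (not_not.1 j.2))).elim), outerInput_self]
    rfl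

variable {H}

/-- The `k`-ary operations `f` on `A` with `ψ (f (a₁, …, a_k)) = f (ψ a₁, …, ψ a_k)`, the
right-hand side formed in `A ⊗ H`. -/
noncomputable def compatibleSubmodule (ψ : A →ₗ[K] A ⊗[K] H) (k : ℕ) :
    Submodule K (MultilinearMap K (fun _ : Fin k => A) A) where
  carrier := {f | ∀ a : Fin k → A, ψ (f a) = extendOp H k f fun j => ψ (a j)}
  zero_mem' a := by simp
  add_mem' {f g} hf hg a := by simp [hf a, hg a]
  smul_mem' c f hf a := by simp [hf a]

theorem mem_compatibleSubmodule {ψ : A →ₗ[K] A ⊗[K] H} {k : ℕ}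
    {f : MultilinearMap K (fun _ : Fin k => A) A} :
    f ∈ compatibleSubmodule ψ k ↔ ∀ a : Fin k → A, ψ (f a) = extendOp H k f fun j => ψ (a j) :=
  Iff.rfl

theorem endComp_mem_compatibleSubmodule (b : Module.Basis (Fin n) K A) {ψ : A →ₗ[K] A ⊗[K] H}
    {k m l : ℕ} (h : l + 1 = k + m) (i : Fin k) {f : MultilinearMap K (fun _ : Fin k => A) A}
    {g : MultilinearMap K (fun _ : Fin m => A) A} (hf : f ∈ compatibleSubmodule ψ k)
    (hg : g ∈ compatibleSubmodule ψ m) : endComp h i f g ∈ compatibleSubmodule ψ l := by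
  intro a
  rw [extendOp_endComp H b, endComp_apply, endComp_apply, hf]
  congr 1
  symm
  refine outerInput_eq h i _ _ _ ?_ fun j hj => ?_
  · rw [outerInput_self]
    exact (hg _).symm
  · rw [outerInput_of_ne h i _ _ hj]

theorem domDomCongr_mem_compatibleSubmodule (b : Module.Basis (Fin n) K A)
    {ψ : A →ₗ[K] A ⊗[K] H} {k : ℕ} (σ : Equiv.Perm (Fin k))
    {f : MultilinearMap K (fun _ : Fin k => A) A} (hf : f ∈ compatibleSubmodule ψ k) :
    f.domDomCongr σ ∈ compatibleSubmodule ψ k := by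
  intro a
  rw [extendOp_domDomCongr H b]
  exact hf _

theorem one_mem_compatibleSubmodule (b : Module.Basis (Fin n) K A) (ψ : A →ₗ[K] A ⊗[K] H) :
    MultilinearMap.ofSubsingleton K A A (0 : Fin 1) LinearMap.id ∈ compatibleSubmodule ψ 1 := by
  intro a
  rw [extendOp_one H b]
  simp

/-- The operations compatible with `ψ` form a suboperad of `End_A`. -/
noncomputable def compatibleOps (b : Module.Basis (Fin n) K A) (ψ : A →ₗ[K] A ⊗[K] H) :
    (endOperad K A).SubOperad where
  carrier := compatibleSubmodule ψ
  one_mem := one_mem_compatibleSubmodule b ψ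
  act_mem σ _ hf := domDomCongr_mem_compatibleSubmodule b σ⁻¹ hf
  comp_mem h i _ _ hf hg := endComp_mem_compatibleSubmodule b h i hf hg

/-- The map `a_i ↦ ∑_s a_s ⊗ c_{si}`. -/
noncomputable def matrixMap (b : Module.Basis (Fin n) K A) (c : Fin n → Fin n → H) : A →ₗ[K] A ⊗[K] H :=
  b.constr K fun i => ∑ s, b s ⊗ₜ[K] c s i

theorem matrixMap_basis (b : Module.Basis (Fin n) K A) (c : Fin n → Fin n → H) (i : Fin n) :
    matrixMap b c (b i) = ∑ s, b s ⊗ₜ[K] c s i := by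
  simp [matrixMap]

theorem matrixMap_apply (b : Module.Basis (Fin n) K A) (c : Fin n → Fin n → H) (x : A) :
    matrixMap b c x = ∑ s, b s ⊗ₜ[K] ∑ u, b.repr x u • c s u := by
  conv_lhs => rw [← b.sum_repr x]
  simp only [map_sum, map_smul, matrixMap_basis, Finset.smul_sum, TensorProduct.tmul_sum,
    TensorProduct.tmul_smul]
  exact Finset.sum_comm

theorem sum_basis_tmul_inj (b : Module.Basis (Fin n) K A) {c c' : Fin n → H}
    (h : ∑ s, b s ⊗ₜ[K] c s = ∑ s, b s ⊗ₜ[K] c' s) : c = c' := by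
  funext t
  have := congrArg (TensorProduct.lid K H ∘ (b.coord t).rTensor H) h
  simpa [Finsupp.single_apply] using this

theorem extendOp_matrixMap (b : Module.Basis (Fin n) K A) {k : ℕ} (f : MultilinearMap K (fun _ : Fin k => A) A)
    (c : Fin n → Fin n → H) (i : Fin k → Fin n) :
    extendOp H k f (fun j => matrixMap b c (b (i j)))
      = ∑ a, b a ⊗ₜ[K] ∑ s : Fin k → Fin n, structConst b f a s • ∏ j, c (s j) (i j) := by
  simp only [matrixMap_basis]
  rw [MultilinearMap.map_sum]
  simp only [extendOp_tmul, TensorProduct.tmul_sum]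
  rw [Finset.sum_comm]
  refine Finset.sum_congr rfl fun s _ => ?_
  conv_lhs => rw [← b.sum_repr (f fun j => b (s j))]
  simp only [TensorProduct.sum_tmul, TensorProduct.tmul_smul, structConst,
    TensorProduct.smul_tmul']

/-- Compatibility of an operation with the map given by a matrix `c` is the vanishing at `c` of the
universal polynomials of the operation. -/
theorem matrixMap_compatible_iff (b : Module.Basis (Fin n) K A) {k : ℕ} (f : MultilinearMap K (fun _ : Fin k => A) A)
    (c : Fin n → Fin n → H) :
    f ∈ compatibleSubmodule (matrixMap b c) k ↔
      ∀ (a : Fin n) (i : Fin k → Fin n),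
        MvPolynomial.aeval (fun q : Fin n × Fin n => c q.1 q.2) (univPoly b f a i) = 0 := by
  have hpoly : ∀ (a : Fin n) (i : Fin k → Fin n),
      MvPolynomial.aeval (fun q : Fin n × Fin n => c q.1 q.2) (univPoly b f a i)
        = ∑ u, structConst b f u i • c a u
          - ∑ s : Fin k → Fin n, structConst b f a s • ∏ j, c (s j) (i j) := by
    intro a i
    simp [univPoly, Algebra.smul_def]
  simp only [hpoly, sub_eq_zero]
  rw [mem_compatibleSubmodule]
  constructor
  · intro h a i
    have := h fun j => b (i j)
    rw [extendOp_matrixMap, matrixMap_apply] at this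
    exact congrFun (sum_basis_tmul_inj b this) a
  · intro h
    have : (matrixMap b c).compMultilinearMap f
        = (extendOp H k f).compLinearMap fun _ => matrixMap b c := by
      refine Module.Basis.ext_multilinear (fun _ => b) fun i => ?_
      change matrixMap b c (f fun j => b (i j)) = extendOp H k f fun j => matrixMap b c (b (i j))
      rw [extendOp_matrixMap, matrixMap_apply]
      exact Finset.sum_congr rfl fun a _ => congrArg _ (h a i)
    exact fun a => DFunLike.congr_fun this a

/-- The ideal of the universal polynomials detects compatibility with the generic matrix modulo an
ideal `I`. -/
theorem univPoly_mem_iff (b : Module.Basis (Fin n) K A) {k : ℕ} (f : MultilinearMap K (fun _ : Fin k => A) A)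
    (I : Ideal (MvPolynomial (Fin n × Fin n) K)) :
    (∀ (a : Fin n) (i : Fin k → Fin n), univPoly b f a i ∈ I) ↔
      f ∈ compatibleSubmodule (matrixMap b fun s i =>
        Ideal.Quotient.mk I (MvPolynomial.X (s, i))) k := by
  rw [matrixMap_compatible_iff]
  have h : (MvPolynomial.aeval fun q : Fin n × Fin n =>
      Ideal.Quotient.mk I (MvPolynomial.X (q.1, q.2))) = Ideal.Quotient.mkₐ K I :=
    MvPolynomial.algHom_ext fun q => by simp
  simp only [h, Ideal.Quotient.mkₐ_eq_mk, Ideal.Quotient.eq_zero_iff_mem]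

end Compatible

/-! ### Dependence of the universal constructions on the operations -/

section SameConstructions

variable {K : Type u} [Field K] {A : Type w} [AddCommGroup A] [Module K A]
  {n : ℕ}

/-- Two sets of operations on `A` impose the same condition on maps `A → A ⊗ H`, for all
commutative algebras `H`. -/
def SameCompatibleMaps (F G : OperationSet K A) : Prop :=
  ∀ (H : Type u) [CommRing H] [Algebra K H] (ψ : A →ₗ[K] A ⊗[K] H),
    (∀ f ∈ F, f.2 ∈ compatibleSubmodule ψ f.1) ↔ ∀ f ∈ G, f.2 ∈ compatibleSubmodule ψ f.1

/-- An ideal contains the universal polynomials exactly if the operations are compatible with the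
generic matrix modulo the ideal. -/
theorem univIdeal_le_iff (b : Module.Basis (Fin n) K A) (F : OperationSet K A)
    (I : Ideal (MvPolynomial (Fin n × Fin n) K)) :
    univIdeal b F ≤ I ↔ ∀ f ∈ F, f.2 ∈ compatibleSubmodule (matrixMap b fun s i =>
        Ideal.Quotient.mk I (MvPolynomial.X (s, i))) f.1 := by
  simp only [← univPoly_mem_iff, univIdeal, Ideal.span_le]
  constructor
  · intro h f hf a i
    exact h ⟨f, hf, a, i, rfl⟩
  · rintro h _ ⟨f, hf, a, i, rfl⟩
    exact h f hf a i

theorem SameCompatibleMaps.univIdeal_eq (b : Module.Basis (Fin n) K A) {F G : OperationSet K A}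
    (h : SameCompatibleMaps F G) : univIdeal b F = univIdeal b G :=
  eq_of_forall_ge_iff fun I => by
    rw [univIdeal_le_iff, univIdeal_le_iff]
    exact h _ _

theorem SameCompatibleMaps.isCoaction_iff {F G : OperationSet K A} (h : SameCompatibleMaps F G)
    {H : Type u} [CommRing H] [Bialgebra K H] (ψ : A →ₗ[K] A ⊗[K] H) :
    IsCoaction F ψ ↔ IsCoaction G ψ :=
  ⟨fun hψ => ⟨hψ.coassoc, hψ.counit, (h H ψ).1 hψ.map_op⟩,
    fun hψ => ⟨hψ.coassoc, hψ.counit, (h H ψ).2 hψ.map_op⟩⟩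

/-- The isomorphism of universal algebras with the same defining ideal. -/
noncomputable def UnivAlg.bialgEquivOfEq (b : Module.Basis (Fin n) K A) {F G : OperationSet K A}
    (h : univIdeal b F = univIdeal b G) : UnivAlg b F ≃ₐc[K] UnivAlg b G :=
  let e : UnivAlg b F ≃ₐ[K] UnivAlg b G := Ideal.quotientEquivAlgOfEq K h
  have he : ∀ s i, e (UnivAlg.x b F s i) = UnivAlg.x b G s i := fun _ _ => rfl
  BialgEquiv.ofAlgEquiv e
    (UnivAlg.hom_ext fun s i => by
      change UnivAlg.counit b G (e (UnivAlg.x b F s i)) = UnivAlg.counit b F (UnivAlg.x b F s i)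
      rw [he, UnivAlg.counit, UnivAlg.counit, UnivAlg.lift_x, UnivAlg.lift_x])
    (UnivAlg.hom_ext fun s i => by
      change Algebra.TensorProduct.map (e : UnivAlg b F →ₐ[K] UnivAlg b G)
        (e : UnivAlg b F →ₐ[K] UnivAlg b G) (UnivAlg.comul b F (UnivAlg.x b F s i))
          = UnivAlg.comul b G (e (UnivAlg.x b F s i))
      rw [he, UnivAlg.comul, UnivAlg.comul, UnivAlg.lift_x, UnivAlg.lift_x]
      simp [he])

theorem UnivAlg.bialgEquivOfEq_x (b : Module.Basis (Fin n) K A) {F G : OperationSet K A}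
    (h : univIdeal b F = univIdeal b G) (s i : Fin n) :
    UnivAlg.bialgEquivOfEq b h (UnivAlg.x b F s i) = UnivAlg.x b G s i := rfl

theorem UnivAlg.bialgEquivOfEq_coaction (b : Module.Basis (Fin n) K A) {F G : OperationSet K A}
    (h : univIdeal b F = univIdeal b G) :
    (UnivAlg.bialgEquivOfEq b h : UnivAlg b F →ₗ[K] UnivAlg b G).lTensor A ∘ₗ
      UnivAlg.coaction b F = UnivAlg.coaction b G := by
  refine b.ext fun i => ?_
  simp only [UnivAlg.coaction, LinearMap.comp_apply, Module.Basis.constr_basis, map_sum,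
    LinearMap.lTensor_tmul]
  rfl

/-- The free commutative Hopf algebra on the universal algebra is transported along
`UnivAlg.bialgEquivOfEq`. -/
theorem IsHopfAlgebraOfUnivAlg.of_univIdeal_eq {b : Module.Basis (Fin n) K A}
    {F G : OperationSet K A} (h : univIdeal b F = univIdeal b G) {H : Type u} [CommRing H]
    [HopfAlgebra K H] {ψ : A →ₗ[K] A ⊗[K] H} (hψ : IsHopfAlgebraOfUnivAlg b F ψ) :
    IsHopfAlgebraOfUnivAlg b G ψ := by
  obtain ⟨v, hv, rfl⟩ := hψ
  let e := UnivAlg.bialgEquivOfEq b h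
  refine ⟨v.comp (e.symm : UnivAlg b G →ₐc[K] UnivAlg b F), fun H' _ _ g => ?_, ?_⟩
  · have hiff : ∀ φ : H →ₐc[K] H', φ.comp (v.comp (e.symm : UnivAlg b G →ₐc[K] UnivAlg b F)) = g ↔
        φ.comp v = g.comp (e : UnivAlg b F →ₐc[K] UnivAlg b G) := by
      intro φ
      constructor
      · rintro rfl
        ext x
        simp
      · intro hφ
        ext x
        simpa using DFunLike.congr_fun hφ (e.symm x)
    simp only [hiff]
    exact hv H' _
  · rw [← UnivAlg.bialgEquivOfEq_coaction b h, ← LinearMap.comp_assoc, ← LinearMap.lTensor_comp]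
    congr 2
    ext x
    exact congrArg v (e.symm_apply_apply x).symm

/-- The universal constructions see the operations only through their compatible maps. -/
theorem SameCompatibleMaps.sameUniversalConstructions (b : Module.Basis (Fin n) K A)
    {F G : OperationSet K A} (h : SameCompatibleMaps F G) : SameUniversalConstructions b F G where
  ideal_eq := h.univIdeal_eq b
  bialgebra_equiv := ⟨UnivAlg.bialgEquivOfEq b (h.univIdeal_eq b),
    UnivAlg.bialgEquivOfEq_x b _, UnivAlg.bialgEquivOfEq_coaction b _⟩
  universal_bialgebra H _ _ ψ := by
    simp only [IsUniversalCoactingBialgebra, h.isCoaction_iff]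
  hopf_of_univAlg H _ _ ψ :=
    ⟨.of_univIdeal_eq (h.univIdeal_eq b), .of_univIdeal_eq (h.univIdeal_eq b).symm⟩
  universal_hopf H _ _ ψ := by
    simp only [IsUniversalCoactingHopfAlgebra, h.isCoaction_iff]

/-- The operations of an algebra over `𝕋(E)/(R)` are compatible with a map `A → A ⊗ H` as soon as
the generating operations are. -/
theorem BinaryQuadraticData.op_mem_compatibleSubmodule (D : BinaryQuadraticData.{u, v} K)
    (b : Module.Basis (Fin n) K A) (γ : D.operad.AlgebraOn A) {H : Type y} [CommRing H]
    [Algebra K H] {ψ : A →ₗ[K] A ⊗[K] H}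
    (h : ∀ e, γ.op (D.gen e) ∈ compatibleSubmodule ψ 2) {k : ℕ} (x : D.operad.obj k) :
    γ.op x ∈ compatibleSubmodule ψ k :=
  D.induction ((compatibleOps b ψ).comap γ) h k x

/-- A set `G` of structure operations whose compatibility implies that of the generating operations
can replace the set of all structure operations. -/
theorem BinaryQuadraticData.sameCompatibleMaps (D : BinaryQuadraticData.{u, v} K)
    (b : Module.Basis (Fin n) K A) (γ : D.operad.AlgebraOn A) {G : OperationSet K A}
    (hG : G ⊆ γ.operations)
    (h : ∀ (H : Type u) [CommRing H] [Algebra K H] (ψ : A →ₗ[K] A ⊗[K] H),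
      (∀ f ∈ G, f.2 ∈ compatibleSubmodule ψ f.1) →
        ∀ e, γ.op (D.gen e) ∈ compatibleSubmodule ψ 2) :
    SameCompatibleMaps γ.operations G := by
  intro H _ _ ψ
  refine ⟨fun hF f hf => hF f (hG hf), fun hf => ?_⟩
  rintro _ ⟨k, x, rfl⟩
  exact D.op_mem_compatibleSubmodule b γ (h H ψ hf) x

/-- The ideal of universal polynomials of an algebra over `𝕋(E)/(R)` is generated by those of a
basis of the arity two operations. -/
theorem BinaryQuadraticData.univIdeal_eq_span (D : BinaryQuadraticData.{u, v} K)
    (b : Module.Basis (Fin n) K A) (γ : D.operad.AlgebraOn A) {ι : Type y}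
    (e : Module.Basis ι K (D.operad.obj 2)) :
    univIdeal b γ.operations
      = Ideal.span {p | ∃ (j : ι) (a : Fin n) (i : Fin 2 → Fin n),
          p = univPoly b (γ.op (e j)) a i} := by
  have hG : SameCompatibleMaps γ.operations {f | ∃ j, f = ⟨2, γ.op (e j)⟩} := by
    refine D.sameCompatibleMaps b γ (by rintro _ ⟨j, rfl⟩; exact ⟨2, e j, rfl⟩) ?_
    intro H _ _ ψ hψ x
    have hle : ⊤ ≤ (compatibleSubmodule ψ 2).comap (γ.app 2) := by
      rw [← e.span_eq, Submodule.span_le]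
      rintro _ ⟨j, rfl⟩
      exact hψ _ ⟨j, rfl⟩
    exact hle (Submodule.mem_top (x := D.gen x))
  rw [hG.univIdeal_eq b, univIdeal]
  congr 1
  ext p
  constructor
  · rintro ⟨_, ⟨j, rfl⟩, a, i, rfl⟩
    exact ⟨j, a, i, rfl⟩
  · rintro ⟨j, a, i, rfl⟩
    exact ⟨_, ⟨j, rfl⟩, a, i, rfl⟩

theorem binaryPoly_eq_univPoly (b : Module.Basis (Fin n) K A)
    (m : MultilinearMap K (fun _ : Fin 2 => A) A) (a : Fin n) (i : Fin 2 → Fin n) :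
    binaryPoly b m a (i 0) (i 1) = univPoly b m a i := by
  have hb : ∀ s : Fin 2 → Fin n, (fun j => b (s j)) = ![b (s 0), b (s 1)] := fun s => by
    ext j
    fin_cases j <;> rfl
  rw [binaryPoly, univPoly, ← (finTwoArrowEquiv (Fin n)).symm.sum_comp, Fintype.sum_prod_type]
  simp [structConst, hb, mul_assoc]

theorem univIdeal_eq_span_binaryPoly (b : Module.Basis (Fin n) K A)
    (S : Set (MultilinearMap K (fun _ : Fin 2 => A) A)) :
    univIdeal b {f | ∃ m ∈ S, f = ⟨2, m⟩}
      = Ideal.span {p | ∃ m ∈ S, ∃ a i j, p = binaryPoly b m a i j} := by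
  rw [univIdeal]
  congr 1
  ext p
  constructor
  · rintro ⟨_, ⟨m, hm, rfl⟩, a, i, rfl⟩
    exact ⟨m, hm, a, i 0, i 1, (binaryPoly_eq_univPoly b m a i).symm⟩
  · rintro ⟨m, hm, a, i, j, rfl⟩
    exact ⟨_, ⟨m, hm, rfl⟩, a, ![i, j], binaryPoly_eq_univPoly b m a ![i, j]⟩

end SameConstructions

/-! ### Algebras over an operad given by generators and relators -/

section Relators

variable {K : Type u} [Field K] {A : Type w} [AddCommGroup A] [Module K A]

theorem endComp_two_zero_apply (h : 3 + 1 = 2 + 2) (f g : MultilinearMap K (fun _ : Fin 2 => A) A)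
    (v : Fin 3 → A) : endComp h 0 f g v = f ![g ![v 0, v 1], v 2] := by
  rw [endComp_apply]
  congr 1
  refine outerInput_eq h 0 _ _ _ ?_ fun j hj => ?_
  · refine congrArg g (funext fun k => ?_)
    fin_cases k <;> rfl
  · fin_cases j
    · exact (hj rfl).elim
    · rfl

theorem endComp_two_one_apply (h : 3 + 1 = 2 + 2) (f g : MultilinearMap K (fun _ : Fin 2 => A) A)
    (v : Fin 3 → A) : endComp h 1 f g v = f ![v 0, g ![v 1, v 2]] := by
  rw [endComp_apply]
  congr 1
  refine outerInput_eq h 1 _ _ _ ?_ fun j hj => ?_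
  · refine congrArg g (funext fun k => ?_)
    fin_cases k <;> rfl
  · fin_cases j
    · rfl
    · exact (hj rfl).elim

theorem vec_two_eta {A : Type w} (v : Fin 2 → A) : ![v 0, v 1] = v := by
  ext j
  fin_cases j <;> rfl

section Operations

variable {P : SymOperad.{u, v} K} (γ : P.AlgebraOn A)

theorem SymOperad.Hom.op_add {k : ℕ} (x y : P.obj k) : γ.op (x + y) = γ.op x + γ.op y :=
  (γ.app k).map_add x y

theorem SymOperad.Hom.op_sub {k : ℕ} (x y : P.obj k) : γ.op (x - y) = γ.op x - γ.op y :=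
  (γ.app k).map_sub x y

theorem SymOperad.Hom.op_act {k : ℕ} (σ : Equiv.Perm (Fin k)) (x : P.obj k) :
    γ.op (P.act k (MulOpposite.op σ) x) = (γ.op x).domDomCongr σ⁻¹ :=
  γ.map_act k σ x

theorem SymOperad.Hom.op_comp {k m l : ℕ} (h : l + 1 = k + m) (i : Fin k) (x : P.obj k)
    (y : P.obj m) : γ.op (P.comp h i x y) = endComp h i (γ.op x) (γ.op y) :=
  γ.map_comp h i x y

end Operations

variable {E : Type v} [AddCommGroup E] [Module K E]
  {ρ : Representation K (Equiv.Perm (Fin 2))ᵐᵒᵖ E}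

section Evaluation

variable (φ : (freeOperad ρ).AlgebraOn A)

theorem op_comp₁ (x y : E) (v : Fin 3 → A) : φ.op (comp₁ ρ x y) v
    = φ.op (freeOperadGen ρ x) ![φ.op (freeOperadGen ρ y) ![v 0, v 1], v 2] := by
  rw [comp₁, φ.op_comp, endComp_two_zero_apply]

theorem op_comp₂ (x y : E) (v : Fin 3 → A) : φ.op (comp₂ ρ x y) v
    = φ.op (freeOperadGen ρ x) ![v 0, φ.op (freeOperadGen ρ y) ![v 1, v 2]] := by
  rw [comp₂, φ.op_comp, endComp_two_one_apply]

theorem op_permute (r : (freeOperad ρ).obj 3) (σ : Equiv.Perm (Fin 3)) (v : Fin 3 → A) :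
    φ.op (permute ρ r σ) v = φ.op r fun j => v (σ⁻¹ j) := by
  rw [permute, φ.op_act, MultilinearMap.domDomCongr_apply]

end Evaluation

variable {S : Set ((freeOperad ρ).obj 3)}

/-- The bilinear operations of an algebra over `𝕋(E)/(R)` that correspond to elements of `E`, for
`R` given by relators. -/
noncomputable def genOp (γ : (BinaryQuadraticData.ofRelators ρ S).operad.AlgebraOn A) :
    E →ₗ[K] MultilinearMap K (fun _ : Fin 2 => A) A :=
  γ.app 2 ∘ₗ (BinaryQuadraticData.ofRelators ρ S).gen

theorem genOp_act (γ : (BinaryQuadraticData.ofRelators ρ S).operad.AlgebraOn A)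
    (σ : Equiv.Perm (Fin 2)) (e : E) :
    genOp γ (ρ (MulOpposite.op σ) e) = (genOp γ e).domDomCongr σ⁻¹ :=
  (congrArg (γ.app 2) ((BinaryQuadraticData.ofRelators ρ S).gen_act σ e)).trans
    (γ.map_act 2 σ _)

/-- The relators vanish in an algebra, seen as an algebra over the free operad. -/
theorem exists_free_algebra (γ : (BinaryQuadraticData.ofRelators ρ S).operad.AlgebraOn A) :
    ∃ φ : (freeOperad ρ).AlgebraOn A, (∀ e, φ.op (freeOperadGen ρ e) = genOp γ e) ∧
      ∀ r ∈ S, φ.op r = 0 := by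
  refine ⟨γ.comp (BinaryQuadraticData.ofRelators ρ S).proj, fun _ => rfl, fun r hr => ?_⟩
  have hr' : r ∈ Submodule.span K {t | ∃ r ∈ S, ∃ σ, t = permute ρ r σ} :=
    Submodule.subset_span ⟨r, hr, 1, by simp [permute]⟩
  exact (congrArg (γ.app 3) ((BinaryQuadraticData.ofRelators ρ S).proj_eq_zero hr')).trans
    (γ.app 3).map_zero

/-- An equivariant family of bilinear operations for which the relators vanish extends to an
algebra structure. -/
theorem exists_algebra_of_relators (f : E →ₗ[K] MultilinearMap K (fun _ : Fin 2 => A) A)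
    (hf : ∀ σ e, f (ρ (MulOpposite.op σ) e) = (f e).domDomCongr σ⁻¹)
    (hS : ∀ φ : (freeOperad ρ).AlgebraOn A, (∀ e, φ.op (freeOperadGen ρ e) = f e) →
      ∀ r ∈ S, φ.op r = 0) :
    ∃ γ : (BinaryQuadraticData.ofRelators ρ S).operad.AlgebraOn A, genOp γ = f := by
  have hspan : ∀ φ : (freeOperad ρ).AlgebraOn A, (∀ e, φ.op (freeOperadGen ρ e) = f e) →
      Submodule.span K {t | ∃ r ∈ S, ∃ σ, t = permute ρ r σ} ≤ LinearMap.ker (φ.app 3) := by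
    intro φ hφ
    refine Submodule.span_le.2 ?_
    rintro _ ⟨r, hr, σ, rfl⟩
    refine (φ.op_act σ r).trans ?_
    rw [hS φ hφ r hr]
    rfl
  obtain ⟨γ, hγ⟩ := (BinaryQuadraticData.ofRelators ρ S).exists_hom (Q := endOperad K A) f hf
    fun φ hφ r hr => hspan φ hφ hr
  exact ⟨γ, LinearMap.ext hγ⟩

variable (ρ) in
/-- `T` generates `E` as an `𝕊₂`-module. -/
def GeneratesModule (T : Set E) : Prop :=
  ∀ M : Submodule K E, (∀ (σ : Equiv.Perm (Fin 2)), ∀ x ∈ M, ρ (MulOpposite.op σ) x ∈ M) →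
    T ⊆ M → ∀ x, x ∈ M

/-- An algebra structure is determined by the operations that correspond to generators of `E`. -/
theorem algebra_ext {T : Set E} (hT : GeneratesModule ρ T)
    {γ γ' : (BinaryQuadraticData.ofRelators ρ S).operad.AlgebraOn A}
    (h : ∀ t ∈ T, genOp γ t = genOp γ' t) : γ = γ' := by
  refine BinaryQuadraticData.hom_ext _ (hT (LinearMap.eqLocus (genOp γ) (genOp γ')) ?_ h)
  intro σ x hx
  rw [LinearMap.mem_eqLocus] at hx ⊢
  rw [genOp_act, genOp_act, hx]

/-- Compatible operations are stable under permutations, so generators of `E` as an `𝕊₂`-module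
suffice. -/
theorem sameCompatibleMaps_generators {n : ℕ} (b : Module.Basis (Fin n) K A) {T : Set E}
    (hT : GeneratesModule ρ T) (γ : (BinaryQuadraticData.ofRelators ρ S).operad.AlgebraOn A) :
    SameCompatibleMaps γ.operations {f | ∃ m ∈ genOp γ '' T, f = ⟨2, m⟩} := by
  refine BinaryQuadraticData.sameCompatibleMaps _ b γ ?_ ?_
  · rintro _ ⟨_, ⟨t, _, rfl⟩, rfl⟩
    exact ⟨2, (BinaryQuadraticData.ofRelators ρ S).gen t, rfl⟩
  · intro H _ _ ψ hψ
    refine hT ((compatibleSubmodule ψ 2).comap (genOp γ)) ?_ fun t ht =>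
      hψ ⟨2, genOp γ t⟩ ⟨_, ⟨t, ht, rfl⟩, rfl⟩
    intro σ x hx
    rw [Submodule.mem_comap] at hx ⊢
    rw [genOp_act]
    exact domDomCongr_mem_compatibleSubmodule b σ⁻¹ hx

/-- Agreement with the classical construction for an operad with one generating operation. -/
theorem agreesWithClassical_of_generator {n : ℕ} (b : Module.Basis (Fin n) K A) {t : E}
    (ht : GeneratesModule ρ {t}) {Law : MultilinearMap K (fun _ : Fin 2 => A) A → Prop}
    (hlaw : ∀ γ : (BinaryQuadraticData.ofRelators ρ S).operad.AlgebraOn A, Law (genOp γ t))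
    (hex : ∀ m, Law m →
      ∃ γ : (BinaryQuadraticData.ofRelators ρ S).operad.AlgebraOn A, genOp γ t = m) :
    AgreesWithClassical b (BinaryQuadraticData.ofRelators ρ S).operad
      ((BinaryQuadraticData.ofRelators ρ S).gen t) Law := by
  refine ⟨fun m hm => ?_, fun γ => ?_⟩
  · obtain ⟨γ, hγ⟩ := hex m hm
    refine ⟨γ, hγ, fun γ' hγ' => algebra_ext ht ?_⟩
    rintro _ rfl
    exact hγ'.trans hγ.symm
  · have h := sameCompatibleMaps_generators b ht γ
    refine ⟨hlaw γ, ?_, ?_⟩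
    · rw [h.univIdeal_eq b, univIdeal_eq_span_binaryPoly]
      simp only [Set.image_singleton, Set.mem_singleton_iff, exists_eq_left]
      rfl
    · have hG : ({⟨2, genOp γ t⟩} : OperationSet K A)
          = {f | ∃ m ∈ genOp γ '' {t}, f = ⟨2, m⟩} := by
        ext f
        simp
      change SameUniversalConstructions b γ.operations {⟨2, genOp γ t⟩}
      rw [hG]
      exact h.sameUniversalConstructions b

/-! ### The associative, Leibniz, Lie and Poisson operads -/

theorem generatesModule_regularGen : GeneratesModule (regularModule K) {regularGen K} := by
  intro M hM h1 x
  induction x using MonoidAlgebra.induction_on with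
  | of σ => simpa [regularModule] using hM σ _ (h1 rfl)
  | add x y hx hy => exact add_mem hx hy
  | smul r x hx => exact M.smul_mem r hx

theorem generatesModule_sign : GeneratesModule (signModule K) {(1 : K)} := by
  intro M _ h1 x
  simpa using M.smul_mem x (h1 rfl)

theorem generatesModule_signTrivial :
    GeneratesModule (signTrivialModule K) {((1, 0) : K × K), (0, 1)} := by
  intro M _ h1 x
  simpa using add_mem (M.smul_mem x.1 (h1 (Or.inl rfl))) (M.smul_mem x.2 (h1 (Or.inr rfl)))

/-- The equivariant map `K[𝕊₂] → End_A(2)` that takes the generator to a given operation. -/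
noncomputable def regularOps (m : MultilinearMap K (fun _ : Fin 2 => A) A) :
    MonoidAlgebra K (Equiv.Perm (Fin 2)) →ₗ[K] MultilinearMap K (fun _ : Fin 2 => A) A :=
  (MonoidAlgebra.basis (Equiv.Perm (Fin 2)) K).constr K fun σ => m.domDomCongr σ⁻¹

theorem regularOps_of (m : MultilinearMap K (fun _ : Fin 2 => A) A) (σ : Equiv.Perm (Fin 2)) :
    regularOps m (MonoidAlgebra.of K _ σ) = m.domDomCongr σ⁻¹ := by
  rw [show MonoidAlgebra.of K _ σ = MonoidAlgebra.basis (Equiv.Perm (Fin 2)) K σ by simp,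
    regularOps, Module.Basis.constr_basis]

theorem regularOps_one (m : MultilinearMap K (fun _ : Fin 2 => A) A) :
    regularOps m (regularGen K) = m :=
  (congrArg _ (map_one (MonoidAlgebra.of K _)).symm).trans (regularOps_of m 1)

theorem regularOps_act (m : MultilinearMap K (fun _ : Fin 2 => A) A) (σ : Equiv.Perm (Fin 2))
    (x : MonoidAlgebra K (Equiv.Perm (Fin 2))) :
    regularOps m (regularModule K (MulOpposite.op σ) x) = (regularOps m x).domDomCongr σ⁻¹ := by
  induction x using MonoidAlgebra.induction_on with
  | of τ =>
    rw [show regularModule K (MulOpposite.op σ) (MonoidAlgebra.of K _ τ)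
      = MonoidAlgebra.of K _ (τ * σ) from (map_mul (MonoidAlgebra.of K _) τ σ).symm,
      regularOps_of, regularOps_of, mul_inv_rev, MultilinearMap.domDomCongr_mul]
  | add x y hx hy =>
    rw [map_add, map_add, hx, hy, map_add]
    rfl
  | smul r x hx =>
    rw [map_smul, map_smul, hx, map_smul]
    rfl

theorem op_leibnizRelator_eq_zero_iff (φ : (freeOperad ρ).AlgebraOn A) (e : E) :
    φ.op (comp₁ ρ e e - comp₂ ρ e e - permute ρ (comp₁ ρ e e) (Equiv.swap 1 2)) = 0 ↔
    IsLeibnizBracket (φ.op (freeOperadGen ρ e)) := by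
  rw [φ.op_sub, φ.op_sub, sub_sub, sub_eq_zero, MultilinearMap.ext_iff]
  simp only [add_apply, op_permute, op_comp₁, op_comp₂]
  exact ⟨fun h x y z => h ![x, y, z], fun h v => h (v 0) (v 1) (v 2)⟩

/-- The cyclic relator on a generator `e` vanishes exactly if the operation of `e` satisfies the
Jacobi identity. -/
theorem op_jacobiRelator_eq_zero_iff (φ : (freeOperad ρ).AlgebraOn A) (e : E) :
    φ.op (comp₁ ρ e e + permute ρ (comp₁ ρ e e) (finRotate 3)
      + permute ρ (comp₁ ρ e e) (finRotate 3)⁻¹) = 0 ↔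
    ∀ x y z, φ.op (freeOperadGen ρ e) ![φ.op (freeOperadGen ρ e) ![x, y], z]
      + φ.op (freeOperadGen ρ e) ![φ.op (freeOperadGen ρ e) ![y, z], x]
      + φ.op (freeOperadGen ρ e) ![φ.op (freeOperadGen ρ e) ![z, x], y] = 0 := by
  have h₀ : (finRotate 3)⁻¹ 0 = 2 := by decide
  have h₁ : (finRotate 3)⁻¹ 1 = 0 := by decide
  have h₂ : (finRotate 3)⁻¹ 2 = 1 := by decide
  have h₀' : finRotate 3 0 = 1 := by decide
  have h₁' : finRotate 3 1 = 2 := by decide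
  have h₂' : finRotate 3 2 = 0 := by decide
  rw [φ.op_add, φ.op_add, MultilinearMap.ext_iff]
  simp only [add_apply, op_permute, op_comp₁, inv_inv, h₀, h₁, h₂, h₀', h₁', h₂']
  constructor
  · intro h x y z
    -- the two rotations appear in the opposite order in the relator
    rw [add_right_comm]
    exact h ![x, y, z]
  · intro h v
    rw [add_right_comm]
    exact h (v 0) (v 1) (v 2)

theorem op_assocRelator_eq_zero_iff (φ : (freeOperad ρ).AlgebraOn A) (e : E) :
    φ.op (comp₁ ρ e e - comp₂ ρ e e) = 0 ↔
    IsAssociativeProduct (φ.op (freeOperadGen ρ e)) := by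
  rw [φ.op_sub, sub_eq_zero, MultilinearMap.ext_iff]
  simp only [op_comp₁, op_comp₂]
  exact ⟨fun h x y z => h ![x, y, z], fun h v => h (v 0) (v 1) (v 2)⟩

theorem op_derivationRelator_eq_zero_iff (φ : (freeOperad ρ).AlgebraOn A) (c m : E) :
    φ.op (comp₁ ρ c m - permute ρ (comp₁ ρ m c) (Equiv.swap 1 2) - comp₂ ρ m c) = 0 ↔
    ∀ x y z, φ.op (freeOperadGen ρ c) ![φ.op (freeOperadGen ρ m) ![x, y], z]
      = φ.op (freeOperadGen ρ m) ![φ.op (freeOperadGen ρ c) ![x, z], y]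
        + φ.op (freeOperadGen ρ m) ![x, φ.op (freeOperadGen ρ c) ![y, z]] := by
  rw [φ.op_sub, φ.op_sub, sub_sub, sub_eq_zero, MultilinearMap.ext_iff]
  simp only [add_apply, op_permute, op_comp₁, op_comp₂]
  exact ⟨fun h x y z => h ![x, y, z], fun h v => h (v 0) (v 1) (v 2)⟩

/-- Antisymmetric binary operations transform by the sign under permutations. -/
theorem domDomCongr_eq_sign_smul {m : MultilinearMap K (fun _ : Fin 2 => A) A}
    (hm : ∀ x y, m ![x, y] = -m ![y, x]) (σ : Equiv.Perm (Fin 2)) :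
    m.domDomCongr σ⁻¹ = ((Equiv.Perm.sign σ : ℤ) : K) • m := by
  ext v
  rw [MultilinearMap.domDomCongr_apply]
  rcases perm_fin_two_eq σ with rfl | rfl
  · rw [inv_one]
    simp
  · have h := hm (v 1) (v 0)
    rw [vec_two_eta v] at h
    rw [show (fun i => v ((Equiv.swap 0 1)⁻¹ i)) = ![v 1, v 0] by ext j; fin_cases j <;> rfl]
    simpa using h

theorem domDomCongr_eq_self {m : MultilinearMap K (fun _ : Fin 2 => A) A}
    (hm : ∀ x y, m ![x, y] = m ![y, x]) (σ : Equiv.Perm (Fin 2)) : m.domDomCongr σ⁻¹ = m := by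
  ext v
  rw [MultilinearMap.domDomCongr_apply]
  rcases perm_fin_two_eq σ with rfl | rfl
  · rw [inv_one]
    simp
  · have h := hm (v 1) (v 0)
    rw [vec_two_eta v] at h
    rw [show (fun i => v ((Equiv.swap 0 1)⁻¹ i)) = ![v 1, v 0] by ext j; fin_cases j <;> rfl]
    simpa using h

theorem swap_of_domDomCongr_eq {m m' : MultilinearMap K (fun _ : Fin 2 => A) A}
    (h : m' = m.domDomCongr (Equiv.swap 0 1)⁻¹) (x y : A) : m' ![x, y] = m ![y, x] := by
  rw [h, MultilinearMap.domDomCongr_apply]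
  refine congrArg m (funext fun j => ?_)
  fin_cases j <;> rfl

/-- Expand `[x + y, x + y] = 0`. -/
theorem IsLieBracket.antisymm {m : MultilinearMap K (fun _ : Fin 2 => A) A} (hm : IsLieBracket m)
    (x y : A) : m ![x, y] = -m ![y, x] := by
  have key : ∀ u v w z : A, m ![u + v, w + z] = m ![u, w] + m ![u, z] + (m ![v, w] + m ![v, z]) := by
    intro u v w z
    have hl : m ![u + v, w + z] = m ![u, w + z] + m ![v, w + z] := m.cons_add ![w + z] u v
    have hr : ∀ t, m ![t, w + z] = m ![t, w] + m ![t, z] := fun t => by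
      simpa using (m.curryLeft t).cons_add ![] w z
    rw [hl, hr, hr]
  have h := key x y x y
  rw [hm.1, hm.1, hm.1, zero_add, add_zero] at h
  exact eq_neg_of_add_eq_zero_left h.symm

theorem alternating_of_antisymm [CharZero K] {m : MultilinearMap K (fun _ : Fin 2 => A) A}
    (hm : ∀ x y, m ![x, y] = -m ![y, x]) (x : A) : m ![x, x] = 0 := by
  have h : (2 : K) • m ![x, x] = 0 := by
    rw [two_smul]
    exact eq_neg_iff_add_eq_zero.1 (hm x x)
  exact (smul_eq_zero.1 h).resolve_left two_ne_zero

section Theorems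

variable {n : ℕ} (b : Module.Basis (Fin n) K A)

theorem ass_agreesWithClassical :
    AgreesWithClassical b (assData K).operad (assMul K) IsAssociativeProduct := by
  refine agreesWithClassical_of_generator b generatesModule_regularGen ?_ ?_
  · intro γ
    obtain ⟨φ, hφ, hS⟩ := exists_free_algebra γ
    rw [← hφ, ← op_assocRelator_eq_zero_iff]
    exact hS _ rfl
  · intro m hm
    obtain ⟨γ, hγ⟩ : ∃ γ : (assData K).operad.AlgebraOn A, genOp γ = regularOps m :=
      exists_algebra_of_relators (regularOps m) (regularOps_act m) (by
      rintro φ hφ _ rfl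
      rwa [op_assocRelator_eq_zero_iff, hφ, regularOps_one])
    exact ⟨γ, by rw [hγ, regularOps_one]⟩

theorem leib_agreesWithClassical :
    AgreesWithClassical b (leibData K).operad (leibBracket K) IsLeibnizBracket := by
  refine agreesWithClassical_of_generator b generatesModule_regularGen ?_ ?_
  · intro γ
    obtain ⟨φ, hφ, hS⟩ := exists_free_algebra γ
    rw [← hφ, ← op_leibnizRelator_eq_zero_iff]
    exact hS _ rfl
  · intro m hm
    obtain ⟨γ, hγ⟩ : ∃ γ : (leibData K).operad.AlgebraOn A, genOp γ = regularOps m :=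
      exists_algebra_of_relators (regularOps m) (regularOps_act m) (by
      rintro φ hφ _ rfl
      rwa [op_leibnizRelator_eq_zero_iff, hφ, regularOps_one])
    exact ⟨γ, by rw [hγ, regularOps_one]⟩

theorem lie_agreesWithClassical [CharZero K] :
    AgreesWithClassical b (lieData K).operad (lieBracket K) IsLieBracket := by
  refine agreesWithClassical_of_generator b generatesModule_sign ?_ ?_
  · intro γ
    obtain ⟨φ, hφ, hS⟩ := exists_free_algebra γ
    refine ⟨alternating_of_antisymm fun x y => ?_, ?_⟩
    · rw [← swap_of_domDomCongr_eq (genOp_act γ (Equiv.swap 0 1) 1)]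
      simp [signModule]
    · rw [← hφ, ← op_jacobiRelator_eq_zero_iff]
      exact hS _ rfl
  · intro m hm
    have h1 : ∀ c, LinearMap.toSpanSingleton K _ m c = c • m := fun _ => rfl
    obtain ⟨γ, hγ⟩ : ∃ γ : (lieData K).operad.AlgebraOn A,
        genOp γ = LinearMap.toSpanSingleton K _ m :=
      exists_algebra_of_relators (LinearMap.toSpanSingleton K _ m) (by
        intro σ c
        rw [h1, h1]
        change _ = c • m.domDomCongr σ⁻¹
        rw [domDomCongr_eq_sign_smul hm.antisymm, smul_smul, mul_comm]
        rfl) (by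
      rintro φ hφ _ rfl
      rw [op_jacobiRelator_eq_zero_iff, hφ, h1, one_smul]
      exact hm.2)
    exact ⟨γ, by rw [hγ, h1, one_smul]⟩

theorem pois_exists_unique (c m : MultilinearMap K (fun _ : Fin 2 => A) A)
    (h : IsPoissonPair c m) : ∃! γ : (poisData K).operad.AlgebraOn A,
      γ.op (poisBracket K) = c ∧ γ.op (poisMul K) = m := by
  obtain ⟨hc, hm, hcomm, hder⟩ := h
  let f : K × K →ₗ[K] MultilinearMap K (fun _ : Fin 2 => A) A :=
    (LinearMap.toSpanSingleton K _ c).coprod (LinearMap.toSpanSingleton K _ m)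
  have hf : ∀ p, f p = p.1 • c + p.2 • m := fun _ => rfl
  have hfc : f (1, 0) = c := by simp [hf]
  have hfm : f (0, 1) = m := by simp [hf]
  obtain ⟨γ, hγ⟩ : ∃ γ : (poisData K).operad.AlgebraOn A, genOp γ = f :=
    exists_algebra_of_relators f (by
      intro σ p
      rw [hf, hf]
      change _ = p.1 • c.domDomCongr σ⁻¹ + p.2 • m.domDomCongr σ⁻¹
      rw [domDomCongr_eq_sign_smul hc.antisymm, domDomCongr_eq_self hcomm, smul_smul, mul_comm]
      rfl) (by
    rintro φ hφ _ (rfl | rfl | rfl)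
    · rw [op_jacobiRelator_eq_zero_iff, hφ, hfc]
      exact hc.2
    · rwa [op_assocRelator_eq_zero_iff, hφ, hfm]
    · rwa [op_derivationRelator_eq_zero_iff, hφ, hφ, hfc, hfm])
  have hγc : genOp γ (1, 0) = c := by rw [hγ, hfc]
  have hγm : genOp γ (0, 1) = m := by rw [hγ, hfm]
  refine ⟨γ, ⟨hγc, hγm⟩, fun γ' hγ' => algebra_ext generatesModule_signTrivial ?_⟩
  rintro _ (rfl | rfl)
  · exact hγ'.1.trans hγc.symm
  · exact hγ'.2.trans hγm.symm

theorem pois_isPoissonPair [CharZero K] (γ : (poisData K).operad.AlgebraOn A) :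
    IsPoissonPair (γ.op (poisBracket K)) (γ.op (poisMul K)) := by
  obtain ⟨φ, hφ, hS⟩ := exists_free_algebra γ
  change IsPoissonPair (genOp γ (1, 0)) (genOp γ (0, 1))
  refine ⟨⟨alternating_of_antisymm fun x y => ?_, ?_⟩, ?_, fun x y => ?_, ?_⟩
  · rw [← swap_of_domDomCongr_eq (genOp_act γ (Equiv.swap 0 1) (1, 0))]
    have h : signTrivialModule K (MulOpposite.op (Equiv.swap 0 1)) (1, 0) = -(1, 0) := by
      simp [signTrivialModule, signModule]
    rw [h, map_neg, neg_apply]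
  · rw [← hφ, ← op_jacobiRelator_eq_zero_iff]
    exact hS _ (Or.inl rfl)
  · rw [← hφ, ← op_assocRelator_eq_zero_iff]
    exact hS _ (Or.inr (Or.inl rfl))
  · rw [← swap_of_domDomCongr_eq (genOp_act γ (Equiv.swap 0 1) (0, 1))]
    have h : signTrivialModule K (MulOpposite.op (Equiv.swap 0 1)) (0, 1) = (0, 1) := by
      simp [signTrivialModule, signModule]
    rw [h]
  · rw [← hφ, ← hφ, ← op_derivationRelator_eq_zero_iff]
    exact hS _ (Or.inr (Or.inr rfl))

theorem pois_sameUniversalConstructions (γ : (poisData K).operad.AlgebraOn A) :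
    univIdeal b γ.operations
        = Ideal.span {p | ∃ a i j, p = binaryPoly b (γ.op (poisBracket K)) a i j ∨
            p = binaryPoly b (γ.op (poisMul K)) a i j} ∧
      SameUniversalConstructions b γ.operations
        {⟨2, γ.op (poisBracket K)⟩, ⟨2, γ.op (poisMul K)⟩} := by
  have h := sameCompatibleMaps_generators b generatesModule_signTrivial γ
  have hset : genOp γ '' {((1, 0) : K × K), (0, 1)} = {γ.op (poisBracket K), γ.op (poisMul K)} :=
    Set.image_pair _ _ _
  rw [hset] at h
  constructor
  · refine (h.univIdeal_eq b).trans ((univIdeal_eq_span_binaryPoly b _).trans ?_)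
    congr 1
    ext p
    constructor
    · rintro ⟨_, (rfl | rfl), a, i, j, rfl⟩
      · exact ⟨a, i, j, Or.inl rfl⟩
      · exact ⟨a, i, j, Or.inr rfl⟩
    · rintro ⟨a, i, j, (rfl | rfl)⟩
      · exact ⟨_, Or.inl rfl, a, i, j, rfl⟩
      · exact ⟨_, Or.inr rfl, a, i, j, rfl⟩
  · have hG : ({⟨2, γ.op (poisBracket K)⟩, ⟨2, γ.op (poisMul K)⟩} : OperationSet K A)
        = {f | ∃ m ∈ ({γ.op (poisBracket K), γ.op (poisMul K)} :
            Set (MultilinearMap K (fun _ : Fin 2 => A) A)), f = ⟨2, m⟩} := by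
      ext f
      simp
    rw [hG]
    exact h.sameUniversalConstructions b

end Theorems

end Relators

theorem theorem5p2 {K : Type u} [Field K] [CharZero K] {A : Type w} [AddCommGroup A] [Module K A]
    {n : ℕ} (b : Module.Basis (Fin n) K A) :
    -- binary quadratic operads `P = 𝕋(E)/(R)`: `P(2) = E`, and `J` is generated by the universal
    -- polynomials of a basis of `P(2)`
    (∀ D : BinaryQuadraticData.{u, v} K,
      Function.Bijective D.gen ∧
      ∀ (γ : D.operad.AlgebraOn A) (ι : Type y) (e : Module.Basis ι K (D.operad.obj 2)),
        univIdeal b γ.operations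
          = Ideal.span {p | ∃ (j : ι) (a : Fin n) (i : Fin 2 → Fin n),
              p = univPoly b (γ.op (e j)) a i}) ∧
    -- agreement with the constructions for associative, Leibniz and Lie algebras
    AgreesWithClassical b (assData K).operad (assMul K) IsAssociativeProduct ∧
    AgreesWithClassical b (leibData K).operad (leibBracket K) IsLeibnizBracket ∧
    AgreesWithClassical b (lieData K).operad (lieBracket K) IsLieBracket ∧
    -- agreement with the constructions for Poisson algebras
    (∀ c m : MultilinearMap K (fun _ : Fin 2 => A) A, IsPoissonPair c m →
      ∃! γ : (poisData K).operad.AlgebraOn A,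
        γ.op (poisBracket K) = c ∧ γ.op (poisMul K) = m) ∧
    (∀ γ : (poisData K).operad.AlgebraOn A,
      IsPoissonPair (γ.op (poisBracket K)) (γ.op (poisMul K)) ∧
      univIdeal b γ.operations
        = Ideal.span {p | ∃ a i j, p = binaryPoly b (γ.op (poisBracket K)) a i j ∨
            p = binaryPoly b (γ.op (poisMul K)) a i j} ∧
      SameUniversalConstructions b γ.operations
        {⟨2, γ.op (poisBracket K)⟩, ⟨2, γ.op (poisMul K)⟩}) :=
  ⟨fun D => ⟨⟨D.gen_injective, D.gen_surjective⟩, fun γ _ e => D.univIdeal_eq_span b γ e⟩,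
    ass_agreesWithClassical b, leib_agreesWithClassical b, lie_agreesWithClassical b,
    pois_exists_unique, fun γ => ⟨pois_isPoissonPair γ, pois_sameUniversalConstructions b γ⟩⟩
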